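/- Conventions. A diffeological space $X$ carries its $D$-topology (a set is open iff its preimage under every plot is open); interiors are taken in this topology. Subsets carry the subspace diffeology and products the product diffeology; $I=[0,1]\subset\mathbf R$ and $I^n=[0,1]^n\subset\mathbf R^n$, with boundary $\partial I^n$ (so $I^0$ is a point and $\partial I^0=\emptyset$). For a diffeological space $X$, $x\in X$ and $n\ge 0$, let $\pi_n(X,x)=[I^n,\partial I^n;X,x]$ be the set of homotopy classes of smooth maps of pairs $(I^n,\partial I^n)\to (X,\{x\})$, where a homotopy is a smooth map $F\colon I^n\times I\to X$ with $F(\partial I^n\times I)\subset\{x\}$. Let $\pi_0(X)$ be the set of smooth path components of $X$. For $N\ge 0$, a smooth map $\phi\colon X\to Y$ is an $N$-equivalence if $\pi_0(X)\to\pi_0(Y)$ is surjective and, for all $x\in X$, the induced map $\phi_*\colon\pi_n(X,x)\to\pi_n(Y,\phi(x))$ is injective for $0\le n<N$ and surjective for $0\le n\le N$. It is a weak homotopy equivalence if it is an $N$-equivalence for all $N\ge 0$; that is, if $\pi_0(X)\to\pi_0(Y)$ is surjective and $\phi_*\colon\pi_n(X,x)\to\pi_n(Y,\phi(x))$ is bijective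 for all $n\ge 0$ and all $x\in X$. If $A_1,A_2$ are subspaces of $X$, then $(X;A_1,A_2)$ is an excisive triad if $X$ is the union of the interiors of $A_1$ and $A_2$. A smooth map of excisive triads $\phi\colon(X;A_1,A_2)\to(Y;B_1,B_2)$ is a smooth map $\phi\colon X\to Y$ with $\phi(A_1)\subset B_1$ and $\phi(A_2)\subset B_2$. Theorem. Let $\phi\colon (X;A_1,A_2)\to (Y;B_1,B_2)$ be a smooth map of excisive triads of diffeological spaces. Suppose that the restrictions $\phi\colon A_1\to B_1$, $\phi\colon A_2\to B_2$ and $\phi\colon A_1\cap A_2\to B_1\cap B_2$ are weak homotopy equivalences. Then $\phi\colon X\to Y$ is a weak homotopy equivalence. -/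

import Mathlib

open Set

namespace Diffeology

universe u v w

/-- The subspace diffeology: a parametrization of `A` is a plot iff it is a plot of `X`. -/
instance instSubspace {X : Type u} [DiffeologicalSpace X] (A : Set X) : DiffeologicalSpace A where
  plots n := {p | IsPlot (fun r : EuclideanSpace ℝ (Fin n) => (p r : X))}
  constant_plots _ := isPlot_const
  plot_reparam hp hf := isPlot_reparam hp hf
  locality {_ p} hp := DiffeologicalSpace.locality (p := fun r => (p r : X)) hp

/-- The product diffeology: a parametrization of `X × Y` is a plot iff both components are. -/
instance instProduct {X : Type u} {Y : Type v} [DiffeologicalSpace X] [DiffeologicalSpace Y] :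
    DiffeologicalSpace (X × Y) where
  plots n := {p | IsPlot (fun r : EuclideanSpace ℝ (Fin n) => (p r).1) ∧
    IsPlot (fun r : EuclideanSpace ℝ (Fin n) => (p r).2)}
  constant_plots _ := ⟨isPlot_const, isPlot_const⟩
  plot_reparam hp hf := ⟨isPlot_reparam hp.1 hf, isPlot_reparam hp.2 hf⟩
  locality {_ p} hp := by
    constructor
    · refine DiffeologicalSpace.locality (p := fun r => (p r).1) fun x => ?_
      obtain ⟨s, hs, hx, h⟩ := hp x
      exact ⟨s, hs, hx, fun hf hf' => (h hf hf').1⟩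
    · refine DiffeologicalSpace.locality (p := fun r => (p r).2) fun x => ?_
      obtain ⟨s, hs, hx, h⟩ := hp x
      exact ⟨s, hs, hx, fun hf hf' => (h hf hf').2⟩

/-- The cube `Iⁿ = [0,1]ⁿ` in `ℝⁿ`; as a type it carries the subspace diffeology. -/
def cube (n : ℕ) : Set (EuclideanSpace ℝ (Fin n)) :=
  {t | ∀ i, t i ∈ Icc (0 : ℝ) 1}

/-- The boundary `∂Iⁿ`, as a subset of `Iⁿ` (empty for `n = 0`). -/
def cubeBoundary (n : ℕ) : Set (cube n) :=
  {t | ∃ i, (t : EuclideanSpace ℝ (Fin n)) i = 0 ∨ (t : EuclideanSpace ℝ (Fin n)) i = 1}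

section Pairs

variable {X : Type u} {Y : Type v} {Z : Type w}
  [DiffeologicalSpace X] [DiffeologicalSpace Y] [DiffeologicalSpace Z]

/-- Smooth maps of pairs `(X, A) → (Y, B)`. -/
def PairMap (A : Set X) (B : Set Y) : Type (max u v) :=
  {f : X → Y // DSmooth f ∧ MapsTo f A B}

/-- Two smooth maps of pairs are homotopic if there is a smooth map `X × I → Y` from one to the
other that sends `A × I` into `B`. -/
def PairHomotopic {A : Set X} {B : Set Y} (f g : PairMap A B) : Prop :=
  ∃ F : X × unitInterval → Y, DSmooth F ∧
    (∀ x, F (x, 0) = f.1 x) ∧ (∀ x, F (x, 1) = g.1 x) ∧ ∀ a ∈ A, ∀ t, F (a, t) ∈ B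

/-- The set `[X, A; Y, B]` of homotopy classes of smooth maps of pairs. -/
def PairHomotopyClasses (A : Set X) (B : Set Y) : Type (max u v) :=
  Quot (PairHomotopic (A := A) (B := B))

/-- Postcomposition with a smooth map of pairs `(Y, B) → (Z, C)`, on homotopy classes. -/
def PairHomotopyClasses.postcomp (A : Set X) {B : Set Y} {C : Set Z} (φ : Y → Z) (hφ : DSmooth φ)
    (hBC : MapsTo φ B C) : PairHomotopyClasses A B → PairHomotopyClasses A C :=
  Quot.map (fun f => ⟨φ ∘ f.1, hφ.comp f.2.1, hBC.comp f.2.2⟩) (by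
    rintro f g ⟨F, hF, h0, h1, hA⟩
    exact ⟨φ ∘ F, hφ.comp hF, fun x => congrArg φ (h0 x), fun x => congrArg φ (h1 x),
      fun a ha t => hBC (hA a ha t)⟩)

end Pairs

section HomotopyGroups

variable {X : Type u} {Y : Type v} [DiffeologicalSpace X] [DiffeologicalSpace Y]

/-- The smooth homotopy set `π_n(X, x) = [Iⁿ, ∂Iⁿ; X, x]`, for every `n ≥ 0`. -/
def HomotopySet (n : ℕ) (X : Type u) [DiffeologicalSpace X] (x : X) : Type u :=
  PairHomotopyClasses (cubeBoundary n) ({x} : Set X)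

/-- The induced map `φ_* : π_n(X, x) → π_n(Y, φ x)`. -/
noncomputable def HomotopySet.map (n : ℕ) (φ : X → Y) (hφ : DSmooth φ) (x : X) : HomotopySet n X x → HomotopySet n Y (φ x) :=
  PairHomotopyClasses.postcomp (cubeBoundary n) φ hφ (mapsTo_singleton.2 rfl)

/-- Two points are joined if there is a smooth path `I → X` from one to the other. -/
def SmoothlyJoined (x y : X) : Prop :=
  ∃ γ : unitInterval → X, DSmooth γ ∧ γ 0 = x ∧ γ 1 = y

/-- The set `π_0 X` of smooth path components (no base point needed, so `X` may be empty). -/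
def PathComponents (X : Type u) [DiffeologicalSpace X] : Type u :=
  Quot (SmoothlyJoined (X := X))

/-- The induced map `π_0 X → π_0 Y` on path components. -/
def PathComponents.map (φ : X → Y) (hφ : DSmooth φ) : PathComponents X → PathComponents Y :=
  Quot.map φ (by
    rintro x y ⟨γ, hγ, h0, h1⟩
    exact ⟨φ ∘ γ, hφ.comp hγ, congrArg φ h0, congrArg φ h1⟩)

/-- `φ` is an `N`-equivalence: at every base point the induced maps on `π_n` are injective for
`n < N` and surjective for `n ≤ N`. The condition on path components follows from the case `n = 0`
unless `X` is empty; in that case it says that `Y` is empty as well. -/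
structure IsNEquivalence (N : ℕ) (φ : X → Y) : Prop where
  smooth : DSmooth φ
  surjective_pathComponents : Function.Surjective (PathComponents.map φ smooth)
  injective : ∀ x n, n < N → Function.Injective (HomotopySet.map n φ smooth x)
  surjective : ∀ x n, n ≤ N → Function.Surjective (HomotopySet.map n φ smooth x)

/-- A weak homotopy equivalence is an `N`-equivalence for all `N`. -/
def IsWeakHomotopyEquivalence (φ : X → Y) : Prop :=
  ∀ N, IsNEquivalence N φ

/-- `(X; A₁, A₂)` is an excisive triad: `X` is the union of the interiors of `A₁` and `A₂` with
respect to the D-topology. -/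
def IsExcisiveTriad (A₁ A₂ : Set X) : Prop :=
  @interior X dTopology A₁ ∪ @interior X dTopology A₂ = univ

end HomotopyGroups

end Diffeology

/-! A weak homotopy equivalence solves every homotopy extension and lifting problem on cubes: given
`α` on the boundary with values in `X`, and a homotopy in `Y` on the open box (sides and bottom)
that ends on the sides in `φ ∘ α`, there is an extension of `α` to the cube and of the homotopy to
one ending in `φ` of that extension (`IsWeakHomotopyEquivalence.liftProp`). Conversely, lifting
cubes relative to their boundary, even only up to reparametrization, gives surjectivity and
injectivity on all `π_n` (`CubeLiftProp.surjective`, `CubeLiftProp.injective`).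

For the triads, a cube in `Y` with a lift of its boundary to `X` is subdivided until, by a Lebesgue
number argument, each small box can be labelled 1 or 2 according to a part of the triad containing
its image (`exists_labels`). A lattice cell then has to be lifted inside the intersection of the
parts labelling the boxes around it, which is the first part, the second, or their intersection. On
each of these `φ` is a weak equivalence, so the lift is built cell by cell, by increasing dimension
and relative to the boundary of the big cube (`exists_lattice_lift`).

The difficulty is smoothness: maps glued along faces are smooth only if they are stationary normal
to the faces. Maps are therefore kept tame, that is, unchanged when coordinates within `ε` of an end
are rounded to that end. Rounding (`kap`) is discontinuous but exact; the smooth `sg` can replace it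
in front of tame maps. Every construction shrinks `ε` by an amount independent of the maps, and this
uniformity is what allows infinitely many cells to be glued at a single scale. -/

open scoped ContDiff Topology

namespace Diffeology

/-! ### Smooth maps on subsets of normed spaces -/

section PlotOn

variable {E E' X Y : Type*} [NormedAddCommGroup E] [NormedSpace ℝ E]
  [NormedAddCommGroup E'] [NormedSpace ℝ E'] [DiffeologicalSpace X] [DiffeologicalSpace Y]

/-- A map defined on a normed space is plotwise smooth on a subset `U` if its composition with
every smooth parametrization of `U` is a plot. -/
def PlotOn (f : E → X) (U : Set E) : Prop :=
  ∀ ⦃n : ℕ⦄ (p : EuclideanSpace ℝ (Fin n) → E), ContDiff ℝ ∞ p → (∀ r, p r ∈ U) →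
    IsPlot (fun r => f (p r))

theorem PlotOn.mono {f : E → X} {U V : Set E} (hf : PlotOn f U) (h : V ⊆ U) : PlotOn f V :=
  fun _ p hp hV => hf p hp fun r => h (hV r)

theorem PlotOn.comp {f : E → X} {U : Set E} {V : Set E'} (hf : PlotOn f U) {g : E' → E}
    (hg : ContDiff ℝ ∞ g) (hV : MapsTo g V U) : PlotOn (fun x => f (g x)) V :=
  fun _ p hp h => hf (fun r => g (p r)) (hg.comp hp) fun r => hV (h r)

theorem PlotOn.congr {f g : E → X} {U : Set E} (hf : PlotOn f U) (h : ∀ x ∈ U, g x = f x) :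
    PlotOn g U := fun _ p hp hU => by
  have : (fun r => g (p r)) = fun r => f (p r) := funext fun r => h _ (hU r)
  rw [this]; exact hf p hp hU

theorem PlotOn.dsmooth_comp {f : E → X} {U : Set E} (hf : PlotOn f U) {φ : X → Y}
    (hφ : DSmooth φ) : PlotOn (fun x => φ (f x)) U :=
  fun _ p hp hU => hφ _ _ (hf p hp hU)

theorem plotOn_const (x : X) (U : Set E) : PlotOn (fun _ => x) U :=
  fun _ _ _ _ => isPlot_const

theorem plotOn_of_locally {f : E → X} {U : Set E}
    (h : ∀ x ∈ U, ∃ V, IsOpen V ∧ x ∈ V ∧ PlotOn f (U ∩ V)) : PlotOn f U := by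
  intro n p hp hU
  refine DiffeologicalSpace.locality (p := fun r => f (p r)) fun r => ?_
  obtain ⟨V, hV, hr, hf⟩ := h (p r) (hU r)
  refine ⟨p ⁻¹' V, hV.preimage hp.continuous, hr, fun {m q} hq hq' => ?_⟩
  exact hf (fun z => p (q z)) (hp.comp hq') fun z => ⟨hU _, hq z⟩

theorem PlotOn.union {f : E → X} {U V : Set E} (hU : IsOpen U) (hV : IsOpen V)
    (hf : PlotOn f U) (hf' : PlotOn f V) : PlotOn f (U ∪ V) :=
  plotOn_of_locally fun _ hx => hx.elim
    (fun h => ⟨U, hU, h, hf.mono inter_subset_right⟩)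
    (fun h => ⟨V, hV, h, hf'.mono inter_subset_right⟩)

end PlotOn

/-! ### Rounding and smooth clamping in one variable -/

section Rounding

/-- Round a real number to `0` if it is below `ε`, and to `1` if it is above `1 - ε`. -/
noncomputable def kap (ε s : ℝ) : ℝ := if s < ε then 0 else if 1 - ε < s then 1 else s

/-- A smooth bump function that is `1` on `[ε, 1 - ε]` and `0` outside `[ε/2, 1 - ε/2]`. -/
noncomputable def chi (ε s : ℝ) : ℝ :=
  Real.smoothTransition (2 * s / ε - 1) * Real.smoothTransition (2 * (1 - s) / ε - 1)

/-- A smooth clamping function: it is the identity on `[ε, 1 - ε]`, `0` below `ε / 2` and `1` above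
`1 - ε / 2`. -/
noncomputable def sg (ε s : ℝ) : ℝ :=
  chi ε s * s + (1 - chi ε s) * Real.smoothTransition (3 * s - 1)

variable {ε δ s : ℝ}

theorem kap_of_lt (h : s < ε) : kap ε s = 0 := if_pos h

theorem kap_of_gt (hε : ε ≤ 1 / 4) (h : 1 - ε < s) : kap ε s = 1 := by
  rw [kap, if_neg (by linarith), if_pos h]

theorem kap_of_mid (h : ε ≤ s) (h' : s ≤ 1 - ε) : kap ε s = s := by
  rw [kap, if_neg (by linarith), if_neg (by linarith)]

theorem kap_cases (ε s : ℝ) (hε : ε ≤ 1 / 4) : (s < ε ∧ kap ε s = 0) ∨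
    (1 - ε < s ∧ kap ε s = 1) ∨ (ε ≤ s ∧ s ≤ 1 - ε ∧ kap ε s = s) := by
  rcases lt_or_ge s ε with h | h
  · exact Or.inl ⟨h, kap_of_lt h⟩
  rcases lt_or_ge (1 - ε) s with h' | h'
  · exact Or.inr (Or.inl ⟨h', kap_of_gt hε h'⟩)
  · exact Or.inr (Or.inr ⟨h, h', kap_of_mid h h'⟩)

theorem kap_kap (hδ : 0 < δ) (hε : ε ≤ 1 / 4) (h : δ ≤ ε) (s : ℝ) :
    kap ε (kap δ s) = kap ε s := by
  rcases kap_cases δ s (h.trans hε) with ⟨h1, h2⟩ | ⟨h1, h2⟩ | ⟨-, -, h2⟩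
  · rw [h2, kap_of_lt (by linarith), kap_of_lt (by linarith)]
  · rw [h2, kap_of_gt hε (by linarith), kap_of_gt hε (by linarith)]
  · rw [h2]

theorem kap_zero (hε : 0 < ε) : kap ε 0 = 0 := kap_of_lt hε

theorem kap_one (hε : 0 < ε) (hε' : ε ≤ 1 / 4) : kap ε 1 = 1 := kap_of_gt hε' (by linarith)

theorem kap_one_sub (hε : ε ≤ 1 / 4) (s : ℝ) : kap ε (1 - s) = 1 - kap ε s := by
  rcases kap_cases ε s hε with ⟨h1, h2⟩ | ⟨h1, h2⟩ | ⟨h, h1, h2⟩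
  · rw [h2, kap_of_gt hε (by linarith)]; ring
  · rw [h2, kap_of_lt (by linarith)]; ring
  · rw [h2, kap_of_mid (by linarith) (by linarith)]

theorem kap_mem (hε : 0 < ε) (hε' : ε ≤ 1 / 4) (s : ℝ) : kap ε s ∈ Icc (0 : ℝ) 1 := by
  rcases kap_cases ε s hε' with ⟨h1, h2⟩ | ⟨h1, h2⟩ | ⟨h, h1, h2⟩ <;> rw [h2]
  · simp
  · simp
  · exact ⟨by linarith, by linarith⟩

theorem kap_lt_iff (hε : 0 < ε) (hε' : ε ≤ 1 / 4) (h : δ ≤ ε) :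
    kap δ s < ε ↔ s < ε := by
  rcases kap_cases δ s (h.trans hε') with ⟨h1, h2⟩ | ⟨h1, h2⟩ | ⟨-, -, h2⟩ <;> rw [h2]
  · constructor <;> intro <;> linarith
  · constructor <;> intro <;> linarith

theorem lt_kap_iff (hε : 0 < ε) (hε' : ε ≤ 1 / 4) (h : δ ≤ ε) :
    1 - ε < kap δ s ↔ 1 - ε < s := by
  rcases kap_cases δ s (h.trans hε') with ⟨h1, h2⟩ | ⟨h1, h2⟩ | ⟨-, -, h2⟩ <;> rw [h2]
  · constructor <;> intro <;> linarith
  · constructor <;> intro <;> linarith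

theorem chi_of_le (hε : 0 < ε) (h : s ≤ ε / 2) : chi ε s = 0 := by
  rw [chi, Real.smoothTransition.zero_of_nonpos, zero_mul]
  rw [sub_nonpos, div_le_one hε]; linarith

theorem chi_of_ge (hε : 0 < ε) (h : 1 - ε / 2 ≤ s) : chi ε s = 0 := by
  rw [chi, mul_comm, Real.smoothTransition.zero_of_nonpos, zero_mul]
  rw [sub_nonpos, div_le_one hε]; linarith

theorem chi_of_mid (hε : 0 < ε) (h : ε ≤ s) (h' : s ≤ 1 - ε) : chi ε s = 1 := by
  rw [chi, Real.smoothTransition.one_of_one_le, Real.smoothTransition.one_of_one_le, mul_one]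
  · rw [le_sub_iff_add_le, le_div_iff₀ hε]; linarith
  · rw [le_sub_iff_add_le, le_div_iff₀ hε]; linarith

theorem chi_nonneg (ε s : ℝ) : 0 ≤ chi ε s :=
  mul_nonneg (Real.smoothTransition.nonneg _) (Real.smoothTransition.nonneg _)

theorem chi_le_one (ε s : ℝ) : chi ε s ≤ 1 :=
  mul_le_one₀ (Real.smoothTransition.le_one _) (Real.smoothTransition.nonneg _)
    (Real.smoothTransition.le_one _)

theorem contDiff_chi (ε : ℝ) : ContDiff ℝ ∞ (chi ε) := by
  unfold chi
  refine ContDiff.mul (Real.smoothTransition.contDiff.comp ?_)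
    (Real.smoothTransition.contDiff.comp ?_)
  · exact ((contDiff_const.mul contDiff_id).div_const _).sub contDiff_const
  · exact ((contDiff_const.mul (contDiff_const.sub contDiff_id)).div_const _).sub contDiff_const

theorem contDiff_sg (ε : ℝ) : ContDiff ℝ ∞ (sg ε) := by
  unfold sg
  refine ((contDiff_chi ε).mul contDiff_id).add ((contDiff_const.sub (contDiff_chi ε)).mul
    (Real.smoothTransition.contDiff.comp ?_))
  exact (contDiff_const.mul contDiff_id).sub contDiff_const

theorem sg_of_le (hε : 0 < ε) (hε' : ε ≤ 1 / 4) (h : s ≤ ε / 2) : sg ε s = 0 := by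
  rw [sg, chi_of_le hε h, Real.smoothTransition.zero_of_nonpos (by linarith)]; ring

theorem sg_of_ge (hε : 0 < ε) (hε' : ε ≤ 1 / 4) (h : 1 - ε / 2 ≤ s) : sg ε s = 1 := by
  rw [sg, chi_of_ge hε h, Real.smoothTransition.one_of_one_le (by linarith)]; ring

theorem sg_of_mid (hε : 0 < ε) (h : ε ≤ s) (h' : s ≤ 1 - ε) : sg ε s = s := by
  rw [sg, chi_of_mid hε h h']; ring

theorem sg_zero (hε : 0 < ε) (hε' : ε ≤ 1 / 4) : sg ε 0 = 0 := sg_of_le hε hε' (by linarith)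

theorem sg_one (hε : 0 < ε) (hε' : ε ≤ 1 / 4) : sg ε 1 = 1 := sg_of_ge hε hε' (by linarith)

theorem sg_left (hε : 0 < ε) (hε' : ε ≤ 1 / 4) (h : s < ε) : 0 ≤ sg ε s ∧ sg ε s < ε := by
  rcases le_or_gt s (ε / 2) with h1 | h1
  · rw [sg_of_le hε hε' h1]; exact ⟨le_rfl, hε⟩
  · rw [sg, Real.smoothTransition.zero_of_nonpos (by linarith)]
    have := chi_nonneg ε s
    have := chi_le_one ε s
    constructor <;> nlinarith

theorem sg_right (hε : 0 < ε) (hε' : ε ≤ 1 / 4) (h : 1 - ε < s) :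
    1 - ε < sg ε s ∧ sg ε s ≤ 1 := by
  rcases le_or_gt (1 - ε / 2) s with h1 | h1
  · rw [sg_of_ge hε hε' h1]; exact ⟨by linarith, le_rfl⟩
  · rw [sg, Real.smoothTransition.one_of_one_le (by linarith)]
    have := chi_nonneg ε s
    have := chi_le_one ε s
    constructor <;> nlinarith

/-- `sg ε` maps each interval collapsed by `kap ε` into itself and fixes the rest. A tame map is
therefore unchanged by precomposition with the smooth `sg ε`, which stands in for rounding wherever
smoothness is to be checked. -/
theorem kap_sg (hε : 0 < ε) (hε' : ε ≤ 1 / 4) (s : ℝ) : kap ε (sg ε s) = kap ε s := by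
  rcases kap_cases ε s hε' with ⟨h1, h2⟩ | ⟨h1, h2⟩ | ⟨h, h1, h2⟩ <;> rw [h2]
  · exact kap_of_lt (sg_left hε hε' h1).2
  · exact kap_of_gt hε' (sg_right hε hε' h1).1
  · rw [sg_of_mid hε h h1, h2]

theorem sg_mem (hε : 0 < ε) (hε' : ε ≤ 1 / 4) (s : ℝ) : sg ε s ∈ Icc (0 : ℝ) 1 := by
  rcases kap_cases ε s hε' with ⟨h1, h2⟩ | ⟨h1, h2⟩ | ⟨h, h1, h2⟩
  · have := sg_left hε hε' h1; exact ⟨this.1, by linarith⟩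
  · have := sg_right hε hε' h1; exact ⟨by linarith, this.2⟩
  · rw [sg_of_mid hε h h1]; exact ⟨by linarith, by linarith⟩

/-- `sg ε` is already constant at distance `ε / 2` from the ends, so precomposition with it makes
any map tame at scale `ε / 2`. This is the source of the halved scales below. -/
theorem sg_kap (hδ : 0 < δ) (h : δ ≤ ε / 2) (hε' : ε ≤ 1 / 4) (s : ℝ) :
    sg ε (kap δ s) = sg ε s := by
  have hε : 0 < ε := by linarith
  rcases kap_cases δ s (by linarith) with ⟨h1, h2⟩ | ⟨h1, h2⟩ | ⟨-, h1, h2⟩ <;> rw [h2]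
  · rw [sg_zero hε hε', sg_of_le hε hε' (by linarith)]
  · rw [sg_one hε hε', sg_of_ge hε hε' (by linarith)]

theorem chi_kap (hδ : 0 < δ) (h : δ ≤ ε / 2) (hε' : ε ≤ 1 / 4) (s : ℝ) :
    chi ε (kap δ s) = chi ε s := by
  have hε : 0 < ε := by linarith
  rcases kap_cases δ s (by linarith) with ⟨h1, h2⟩ | ⟨h1, h2⟩ | ⟨-, h1, h2⟩ <;> rw [h2]
  · rw [chi_of_le hε (by linarith), chi_of_le hε (by linarith)]
  · rw [chi_of_ge hε (by linarith), chi_of_ge hε (by linarith)]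

end Rounding

/-! ### Collars of the boundary of the cube -/

section Collar

variable {ι : Type*}

/-- Coordinatewise rounding. -/
noncomputable def kapv (ε : ℝ) (t : ι → ℝ) : ι → ℝ := fun i => kap ε (t i)

/-- Coordinatewise smooth clamping. -/
noncomputable def sgv (ε : ℝ) (t : ι → ℝ) : ι → ℝ := fun i => sg ε (t i)

/-- The `ε`-collar of the boundary of the unit cube, together with the outside of the cube. -/
def col (ι : Type*) (ε : ℝ) : Set (ι → ℝ) := {t | ∃ i, t i < ε ∨ 1 - ε < t i}

variable {ε δ : ℝ} {t : ι → ℝ}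

theorem kapv_kapv (hδ : 0 < δ) (hε : ε ≤ 1 / 4) (h : δ ≤ ε) (t : ι → ℝ) :
    kapv ε (kapv δ t) = kapv ε t := funext fun i => kap_kap hδ hε h (t i)

theorem kapv_sgv (hε : 0 < ε) (hε' : ε ≤ 1 / 4) (t : ι → ℝ) : kapv ε (sgv ε t) = kapv ε t :=
  funext fun i => kap_sg hε hε' (t i)

theorem sgv_kapv (hδ : 0 < δ) (h : δ ≤ ε / 2) (hε' : ε ≤ 1 / 4) (t : ι → ℝ) :
    sgv ε (kapv δ t) = sgv ε t := funext fun i => sg_kap hδ h hε' (t i)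

theorem col_mono (h : δ ≤ ε) : col ι δ ⊆ col ι ε := by
  rintro t ⟨i, hi | hi⟩
  · exact ⟨i, Or.inl (by linarith)⟩
  · exact ⟨i, Or.inr (by linarith)⟩

theorem kapv_mem_col (hδ : 0 < δ) (hε : ε ≤ 1 / 4) (h : δ ≤ ε) :
    kapv δ t ∈ col ι ε ↔ t ∈ col ι ε := by
  have h0 : 0 < ε := by linarith
  simp only [col, kapv, mem_ofPred_eq, kap_lt_iff h0 hε h, lt_kap_iff h0 hε h]

theorem isOpen_col [Finite ι] (ε : ℝ) : IsOpen (col ι ε) := by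
  have : col ι ε = ⋃ i, {t | t i < ε} ∪ {t | 1 - ε < t i} := by
    ext t; simp [col]
  rw [this]
  exact isOpen_iUnion fun i => (isOpen_lt (continuous_apply i) continuous_const).union
    (isOpen_lt continuous_const (continuous_apply i))

theorem contDiff_sgv [Fintype ι] (ε : ℝ) : ContDiff ℝ ∞ (sgv (ι := ι) ε) :=
  contDiff_pi.2 fun i => (contDiff_sg ε).comp (contDiff_apply ℝ ℝ i)

end Collar

/-! ### Tame maps, box filling and homotopy extension -/

section Extension

variable {ι X : Type*} {ε δ : ℝ}

/-- A function on the cube is tame if it only depends on the rounded coordinates. -/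
def Tame (ε : ℝ) (f : (ι → ℝ) → X) : Prop := ∀ t, f (kapv ε t) = f t

/-- A homotopy on the cube is tame if it only depends on the rounded coordinates. -/
def Tame₂ (ε : ℝ) (f : (ι → ℝ) → ℝ → X) : Prop := ∀ t s, f (kapv ε t) (kap ε s) = f t s

theorem Tame.mono {f : (ι → ℝ) → X} (hf : Tame ε f) (hδ : 0 < δ) (hε : ε ≤ 1 / 4) (h : δ ≤ ε) :
    Tame δ f := fun t => by rw [← hf, kapv_kapv hδ hε h, hf]

theorem Tame₂.mono {f : (ι → ℝ) → ℝ → X} (hf : Tame₂ ε f) (hδ : 0 < δ) (hε : ε ≤ 1 / 4)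
    (h : δ ≤ ε) : Tame₂ δ f := fun t s => by
  rw [← hf, kapv_kapv hδ hε h, kap_kap hδ hε h, hf]

theorem Tame.sgv {f : (ι → ℝ) → X} (hf : Tame ε f) (hε : 0 < ε) (hε' : ε ≤ 1 / 4) (t : ι → ℝ) :
    f (sgv ε t) = f t := by rw [← hf, kapv_sgv hε hε', hf]

theorem Tame₂.left {f : (ι → ℝ) → ℝ → X} (hf : Tame₂ ε f) (hε : 0 < ε) (hε' : ε ≤ 1 / 4)
    (s : ℝ) : Tame ε (fun t => f t s) := fun t => by
  change f (kapv ε t) s = f t s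
  rw [← hf, kapv_kapv hε hε' le_rfl, hf]

theorem Tame₂.right {f : (ι → ℝ) → ℝ → X} (hf : Tame₂ ε f) (hε : 0 < ε) (hε' : ε ≤ 1 / 4)
    (t : ι → ℝ) (s : ℝ) : f t (kap ε s) = f t s := by
  rw [← hf, kap_kap hε hε' le_rfl, hf]

theorem Tame₂.sg {f : (ι → ℝ) → ℝ → X} (hf : Tame₂ ε f) (hε : 0 < ε) (hε' : ε ≤ 1 / 4)
    (t : ι → ℝ) (s : ℝ) : f t (sg ε s) = f t s := by
  rw [← hf.right hε hε', kap_sg hε hε', hf.right hε hε']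

theorem Tame₂.of_lt {f : (ι → ℝ) → ℝ → X} (hf : Tame₂ ε f) (hε : 0 < ε) (hε' : ε ≤ 1 / 4)
    (t : ι → ℝ) {s : ℝ} (hs : s < ε) : f t s = f t 0 := by
  rw [← hf.right hε hε', kap_of_lt hs]

theorem Tame₂.of_gt {f : (ι → ℝ) → ℝ → X} (hf : Tame₂ ε f) (hε : 0 < ε) (hε' : ε ≤ 1 / 4)
    (t : ι → ℝ) {s : ℝ} (hs : 1 - ε < s) : f t s = f t 1 := by
  rw [← hf.right hε hε', kap_of_gt hε' hs]

variable [Fintype ι] [DiffeologicalSpace X]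

/-- Box filling: a tame map on the open box is filled by composing it with a smooth map into the
box. -/
theorem exists_fill (hε : 0 < ε) (hε' : ε ≤ 1 / 4) {h : (ι → ℝ) → ℝ → X} (hh : Tame₂ ε h)
    (hs : PlotOn (fun p : (ι → ℝ) × ℝ => h p.1 p.2) {p | p.1 ∈ col ι ε ∨ p.2 < ε}) :
    ∃ G : (ι → ℝ) → ℝ → X, Tame₂ (ε / 2) G ∧
      PlotOn (fun p : (ι → ℝ) × ℝ => G p.1 p.2) univ ∧
      (∀ t ∈ col ι (ε / 2), ∀ s, G t s = h t s) ∧ ∀ t, G t 0 = h t 0 := by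
  -- The factor `1 - ∏ chi` vanishes off the `ε`-collar, so the pair always lies in the open box; on
  -- the `ε / 2`-collar it is `1`, so nothing changes there.
  refine ⟨fun t s => h t (sg ε s * (1 - ∏ i, chi ε (t i))), fun t s => ?_, ?_, ?_, fun t => ?_⟩
  · have h1 : ∀ i, chi ε (kapv (ε / 2) t i) = chi ε (t i) :=
      fun i => chi_kap (by linarith) le_rfl hε' (t i)
    simp only [h1, sg_kap (half_pos hε) le_rfl hε']
    rw [← hh, kapv_kapv (half_pos hε) hε' (by linarith), hh]
  · refine PlotOn.comp (g := fun p : (ι → ℝ) × ℝ => (p.1, sg ε p.2 * (1 - ∏ i, chi ε (p.1 i))))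
      hs ?_ ?_
    · refine contDiff_fst.prodMk (((contDiff_sg ε).comp contDiff_snd).mul (contDiff_const.sub ?_))
      exact contDiff_prod fun i _ => (contDiff_chi ε).comp
        ((contDiff_apply ℝ ℝ i).comp contDiff_fst)
    · intro p _
      by_cases hp : p.1 ∈ col ι ε
      · exact Or.inl hp
      · right
        have : ∏ i, chi ε (p.1 i) = 1 := Finset.prod_eq_one fun i _ => by
          simp only [col, mem_ofPred_eq, not_exists, not_or, not_lt] at hp
          exact chi_of_mid hε (hp i).1 (hp i).2
        simp only [this]; linarith
  · rintro t ⟨i, hi⟩ s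
    have : ∏ i, chi ε (t i) = 0 := Finset.prod_eq_zero (Finset.mem_univ i) (by
      rcases hi with hi | hi
      · exact chi_of_le hε hi.le
      · exact chi_of_ge hε hi.le)
    simp only [this, sub_zero, mul_one]
    exact hh.sg hε hε' t s
  · simp only [sg_zero hε hε', zero_mul]

open Classical in
/-- Extension of tame homotopies from the collar to the cube. -/
theorem exists_homotopy_ext (hε : 0 < ε) (hε' : ε ≤ 1 / 4) {g₀ : (ι → ℝ) → X}
    {g : (ι → ℝ) → ℝ → X} (h₀ : Tame ε g₀) (hg : Tame₂ ε g) (hs₀ : PlotOn g₀ univ)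
    (hs : PlotOn (fun p : (ι → ℝ) × ℝ => g p.1 p.2) {p | p.1 ∈ col ι ε})
    (h : ∀ t ∈ col ι ε, g t 0 = g₀ t) :
    ∃ G : (ι → ℝ) → ℝ → X, Tame₂ (ε / 2) G ∧
      PlotOn (fun p : (ι → ℝ) × ℝ => G p.1 p.2) univ ∧
      (∀ t ∈ col ι (ε / 2), ∀ s, G t s = g t s) ∧ ∀ t, G t 0 = g₀ t := by
  obtain ⟨G, h1, h2, h3, h4⟩ := exists_fill (X := X) hε hε'
    (h := fun t s => if t ∈ col ι ε then g t s else g₀ t) (by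
      intro t s
      simp only [kapv_mem_col hε hε' le_rfl, hg t s, h₀ t]) (by
      -- The two pieces agree on the open overlap because tameness makes `g` stationary for times
      -- below `ε`.
      refine PlotOn.union (U := {p : (ι → ℝ) × ℝ | p.1 ∈ col ι ε}) (V := {p | p.2 < ε})
        ((isOpen_col ε).preimage continuous_fst) (isOpen_lt continuous_snd continuous_const)
        (hs.congr fun p hp => if_pos hp) ?_
      refine (hs₀.comp (g := Prod.fst) contDiff_fst (mapsTo_univ _ _)).congr fun p hp => ?_
      by_cases hc : p.1 ∈ col ι ε
      · rw [if_pos hc, hg.of_lt hε hε' _ hp, h _ hc]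
      · rw [if_neg hc])
  refine ⟨G, h1, h2, fun t ht s => ?_, fun t => ?_⟩
  · rw [h3 t ht, if_pos (col_mono (by linarith) ht)]
  · rw [h4]
    split_ifs with hc
    · exact h t hc
    · rfl

/-- Extension of tame homotopies from the collar to the cube, with the map given at time `1`. -/
theorem exists_homotopy_ext_one (hε : 0 < ε) (hε' : ε ≤ 1 / 4) {g₁ : (ι → ℝ) → X}
    {g : (ι → ℝ) → ℝ → X} (h₁ : Tame ε g₁) (hg : Tame₂ ε g) (hs₁ : PlotOn g₁ univ)
    (hs : PlotOn (fun p : (ι → ℝ) × ℝ => g p.1 p.2) {p | p.1 ∈ col ι ε})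
    (h : ∀ t ∈ col ι ε, g t 1 = g₁ t) :
    ∃ G : (ι → ℝ) → ℝ → X, Tame₂ (ε / 2) G ∧
      PlotOn (fun p : (ι → ℝ) × ℝ => G p.1 p.2) univ ∧
      (∀ t ∈ col ι (ε / 2), ∀ s, G t s = g t s) ∧ ∀ t, G t 1 = g₁ t := by
  have hrev : ContDiff ℝ ∞ (fun p : (ι → ℝ) × ℝ => (p.1, 1 - p.2)) :=
    contDiff_fst.prodMk (contDiff_const.sub contDiff_snd)
  obtain ⟨G, h1, h2, h3, h4⟩ := exists_homotopy_ext hε hε' (g := fun t s => g t (1 - s)) h₁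
    (fun t s => by beta_reduce; rw [← kap_one_sub hε', hg]) hs₁ (hs.comp hrev fun p hp => hp)
    (fun t ht => by rw [sub_zero, h t ht])
  refine ⟨fun t s => G t (1 - s), fun t s => ?_, h2.comp hrev (mapsTo_univ _ _), fun t ht s => ?_,
    fun t => ?_⟩
  · beta_reduce
    rw [← kap_one_sub (by linarith), h1]
  · beta_reduce
    rw [h3 t ht, sub_sub_cancel]
  · beta_reduce
    rw [sub_self, h4]

end Extension

/-! ### Homotopy extension and lifting problems on cubes -/

section Lifting

variable {ι X Y : Type*} {ε δ : ℝ}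

/-- The point of the cube over `Option ι` with coordinate `τ` at `none` and `t` at the others. -/
def ocons (t : ι → ℝ) (τ : ℝ) : Option ι → ℝ := fun o => o.elim τ t

/-- The coordinates other than `none`. -/
def otail (u : Option ι → ℝ) : ι → ℝ := fun i => u (some i)

@[simp] theorem otail_ocons (t : ι → ℝ) (τ : ℝ) : otail (ocons t τ) = t := rfl

@[simp] theorem ocons_none (t : ι → ℝ) (τ : ℝ) : ocons t τ none = τ := rfl

@[simp] theorem otail_kapv (u : Option ι → ℝ) : otail (kapv ε u) = kapv ε (otail u) := rfl

@[simp] theorem kapv_none (u : Option ι → ℝ) : kapv ε u none = kap ε (u none) := rfl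

theorem kapv_ocons (t : ι → ℝ) (τ : ℝ) : kapv ε (ocons t τ) = ocons (kapv ε t) (kap ε τ) := by
  funext o; cases o <;> rfl

theorem ocons_otail (u : Option ι → ℝ) : ocons (otail u) (u none) = u := by
  funext o; cases o <;> rfl

theorem mem_col_option {u : Option ι → ℝ} :
    u ∈ col (Option ι) ε ↔ (otail u ∈ col ι ε ∨ u none < ε) ∨ 1 - ε < u none := by
  simp only [col, mem_ofPred_eq, Option.exists, otail]
  constructor <;> rintro ((h | h) | h) <;> simp only [h, true_or, or_true]

theorem contDiff_otail [Fintype ι] : ContDiff ℝ ∞ (otail (ι := ι)) :=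
  contDiff_pi.2 fun i => contDiff_apply ℝ ℝ (some i)

theorem contDiff_ocons [Fintype ι] :
    ContDiff ℝ ∞ (fun p : (ι → ℝ) × ℝ => ocons p.1 p.2) :=
  contDiff_pi.2 fun o => by
    cases o with
    | none => exact contDiff_snd
    | some i => exact (contDiff_apply ℝ ℝ i).comp contDiff_fst

variable [Fintype ι] [DiffeologicalSpace X] [DiffeologicalSpace Y] {φ : X → Y}

/-- A lifting problem: a map to `X` on the boundary of the cube, and a map to `Y` on the open box
whose top is the image of the former. -/
structure LiftDatum (φ : X → Y) (ε : ℝ) (α : (ι → ℝ) → X) (h : (ι → ℝ) → ℝ → Y) : Prop where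
  tame : Tame ε α
  tame₂ : Tame₂ ε h
  smooth : PlotOn α (col ι ε)
  smooth₂ : PlotOn (fun p : (ι → ℝ) × ℝ => h p.1 p.2) {p | p.1 ∈ col ι ε ∨ p.2 < ε}
  top : ∀ t ∈ col ι ε, h t 1 = φ (α t)

/-- A solution of a lifting problem. -/
structure LiftSolution (φ : X → Y) (ε : ℝ) (α : (ι → ℝ) → X) (h : (ι → ℝ) → ℝ → Y)
    (α' : (ι → ℝ) → X) (H : (ι → ℝ) → ℝ → Y) : Prop where
  tame : Tame ε α'
  tame₂ : Tame₂ ε H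
  smooth : PlotOn α' univ
  smooth₂ : PlotOn (fun p : (ι → ℝ) × ℝ => H p.1 p.2) univ
  eq : ∀ t ∈ col ι ε, α' t = α t
  eq₂ : ∀ t ∈ col ι ε, ∀ s, H t s = h t s
  zero : ∀ t, H t 0 = h t 0
  one : ∀ t, H t 1 = φ (α' t)

theorem LiftSolution.mono {α : (ι → ℝ) → X} {h : (ι → ℝ) → ℝ → Y} {α' : (ι → ℝ) → X}
    {H : (ι → ℝ) → ℝ → Y} (S : LiftSolution φ ε α h α' H) (hδ : 0 < δ) (hε : ε ≤ 1 / 4)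
    (hle : δ ≤ ε) : LiftSolution φ δ α h α' H where
  tame := S.tame.mono hδ hε hle
  tame₂ := S.tame₂.mono hδ hε hle
  smooth := S.smooth
  smooth₂ := S.smooth₂
  eq t ht := S.eq t (col_mono hle ht)
  eq₂ t ht := S.eq₂ t (col_mono hle ht)
  zero := S.zero
  one := S.one

open Classical in
/-- Solvability of lifting problems is invariant under homotopies of lifting problems. -/
theorem LiftSolution.transfer (hε : 0 < ε) (hε' : ε ≤ 1 / 4) (hφ : DSmooth φ)
    {α : (ι → ℝ) → ℝ → X} {h : (ι → ℝ) → ℝ → ℝ → Y} (hα : Tame₂ ε α)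
    (hh : ∀ t τ s, h (kapv ε t) (kap ε τ) (kap ε s) = h t τ s)
    (sα : PlotOn (fun p : (ι → ℝ) × ℝ => α p.1 p.2) {p | p.1 ∈ col ι ε})
    (sh : PlotOn (fun p : (ι → ℝ) × ℝ × ℝ => h p.1 p.2.1 p.2.2) {p | p.1 ∈ col ι ε ∨ p.2.1 < ε})
    (top : ∀ t ∈ col ι ε, ∀ s, h t 1 s = φ (α t s)) {α₀ : (ι → ℝ) → X} {H₀ : (ι → ℝ) → ℝ → Y}
    (S : LiftSolution φ ε (fun t => α t 0) (fun t τ => h t τ 0) α₀ H₀) :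
    ∃ α₁ H₁, LiftSolution φ (ε / 4) (fun t => α t 1) (fun t τ => h t τ 1) α₁ H₁ := by
  -- `A` carries the known lift along the homotopy of boundary maps.
  obtain ⟨A, A1, A2, A3, A4⟩ := exists_homotopy_ext hε hε' S.tame hα S.smooth sα
    (fun t ht => (S.eq t ht).symm)
  set δ := ε / 2 with hδ
  have hδ0 : 0 < δ := by positivity
  have hδ' : δ ≤ 1 / 4 := by linarith
  have hle : δ ≤ ε := by linarith
  have hh' : ∀ t τ s, h (kapv δ t) (kap δ τ) (kap δ s) = h t τ s := fun t τ s => by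
    rw [← hh, kapv_kapv hδ0 hε' hle, kap_kap hδ0 hε' hle, kap_kap hδ0 hε' hle, hh]
  have hτ : ∀ t τ s, h t (kap δ τ) s = h t τ s := fun t τ s => by
    rw [← hh', kap_kap hδ0 hδ' le_rfl, hh']
  -- The known homotopy `H₀`, viewed as a map on the cube in the variables `(t, τ)`, is deformed
  -- with prescribed boundary: `h` on the open box and `φ ∘ A` on the top. The solution is read off
  -- at time 1. Two extensions halve `ε` twice.
  obtain ⟨G, G1, G2, G3, G4⟩ := exists_homotopy_ext (ι := Option ι) (X := Y) hδ0 hδ'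
    (g₀ := fun u => H₀ (otail u) (u none))
    (g := fun u s => if otail u ∈ col ι δ ∨ u none < δ then h (otail u) (u none) s
      else φ (A (otail u) s))
    (fun u => (S.tame₂.mono hδ0 hε' hle) _ _)
    (fun u s => by
      simp only [otail_kapv, kapv_none, kapv_mem_col hδ0 hδ' le_rfl, kap_lt_iff hδ0 hδ' le_rfl,
        hh', A1 _ s])
    (S.smooth₂.comp (g := fun u : Option ι → ℝ => (otail u, u none))
      (contDiff_otail.prodMk (contDiff_apply ℝ ℝ none)) (mapsTo_univ _ _))
    (by
      have c1 : Continuous fun p : (Option ι → ℝ) × ℝ => otail p.1 :=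
        contDiff_otail.continuous.comp continuous_fst
      have c2 : Continuous fun p : (Option ι → ℝ) × ℝ => p.1 none :=
        (continuous_apply none).comp continuous_fst
      refine PlotOn.mono (U := {p : (Option ι → ℝ) × ℝ | otail p.1 ∈ col ι δ ∨ p.1 none < δ} ∪
        {p | 1 - δ < p.1 none}) (PlotOn.union ?_ ?_ ?_ ?_) (fun p hp => mem_col_option.1 hp)
      · exact ((isOpen_col δ).preimage c1).union (isOpen_lt c2 continuous_const)
      · exact isOpen_lt continuous_const c2
      · refine (sh.comp (g := fun p : (Option ι → ℝ) × ℝ => (otail p.1, p.1 none, p.2)) ?_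
          ?_).congr fun p hp => if_pos hp
        · exact (contDiff_otail.comp contDiff_fst).prodMk
            (((contDiff_apply ℝ ℝ none).comp contDiff_fst).prodMk contDiff_snd)
        · exact fun p hp => hp.imp (fun h => col_mono hle h) (fun h => lt_of_lt_of_le h hle)
      · refine ((A2.dsmooth_comp hφ).comp (g := fun p : (Option ι → ℝ) × ℝ => (otail p.1, p.2))
          ((contDiff_otail.comp contDiff_fst).prodMk contDiff_snd)
          (mapsTo_univ _ _)).congr fun p hp => ?_
        split_ifs with hc
        · rcases hc with hc | hc
          · rw [← hτ, kap_of_gt hδ' hp, top _ (col_mono hle hc), A3 _ hc]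
          · have : 1 - δ < p.1 none := hp
            linarith
        · rfl)
    (fun u hu => by
      rw [mem_col_option] at hu
      split_ifs with hc
      · by_cases ht : otail u ∈ col ι δ
        · exact (S.eq₂ _ (col_mono hle ht) _).symm
        · have hu' : u none < δ := hc.resolve_left ht
          rw [← hτ, kap_of_lt hu', (S.tame₂.mono hδ0 hε' hle).of_lt hδ0 hδ' _ hu', S.zero]
      · rw [A4, (S.tame₂.mono hδ0 hε' hle).of_gt hδ0 hδ' _ (hu.resolve_left hc), S.one])
  have h4 : ε / 4 = δ / 2 := by rw [hδ]; ring
  rw [h4]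
  refine ⟨fun t => A t 1, fun t τ => G (ocons t τ) 1, ?_, ?_, ?_, ?_, ?_, ?_, ?_, ?_⟩
  · exact (A1.left hδ0 hδ' 1).mono (by linarith) hδ' (by linarith)
  · intro t τ
    beta_reduce
    rw [← kapv_ocons]
    exact G1.left (by linarith) (by linarith) 1 _
  · exact A2.comp (g := fun t => (t, (1 : ℝ))) (contDiff_id.prodMk contDiff_const)
      (mapsTo_univ _ _)
  · exact G2.comp (g := fun p : (ι → ℝ) × ℝ => (ocons p.1 p.2, (1 : ℝ)))
      (contDiff_ocons.prodMk contDiff_const) (mapsTo_univ _ _)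
  · exact fun t ht => A3 t (col_mono (by linarith) ht) 1
  · intro t ht s
    rw [G3 _ (mem_col_option.2 (Or.inl (Or.inl (by rwa [otail_ocons])))), otail_ocons, ocons_none,
      if_pos (Or.inl (col_mono (by linarith) ht))]
  · intro t
    rw [G3 _ (mem_col_option.2 (Or.inl (Or.inr (by rw [ocons_none]; positivity)))),
      otail_ocons, ocons_none, if_pos (Or.inr hδ0)]
  · intro t
    rw [G3 _ (mem_col_option.2 (Or.inr (by rw [ocons_none]; linarith))), otail_ocons, ocons_none]
    split_ifs with hc
    · rcases hc with hc | hc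
      · rw [top _ (col_mono hle hc), A3 _ hc]
      · linarith
    · rfl

/-- A lifting problem whose homotopy is stationary. -/
structure StrictDatum (φ : X → Y) (ε : ℝ) (α : (ι → ℝ) → X) (β : (ι → ℝ) → Y) : Prop where
  tame : Tame ε α
  tame' : Tame ε β
  smooth : PlotOn α (col ι ε)
  smooth' : PlotOn β univ
  comm : ∀ t ∈ col ι ε, β t = φ (α t)

/-- A solution of a strict lifting problem. -/
def StrictSolvable (φ : X → Y) (ε : ℝ) (α : (ι → ℝ) → X) (β : (ι → ℝ) → Y) : Prop :=
  ∃ α' H, LiftSolution φ ε α (fun t _ => β t) α' H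

variable (ι) in
/-- All lifting problems on cubes over `ι` are solvable, with uniform tameness. -/
def LiftProp (φ : X → Y) : Prop :=
  ∀ ε, 0 < ε → ε ≤ 1 / 4 → ∃ δ, 0 < δ ∧ δ ≤ ε ∧ ∀ (α : (ι → ℝ) → X) (h : (ι → ℝ) → ℝ → Y),
    LiftDatum φ ε α h → ∃ α' H, LiftSolution φ δ α h α' H

variable (ι) in
/-- All strict lifting problems on cubes over `ι` are solvable, with uniform tameness. -/
def StrictLiftProp (φ : X → Y) : Prop :=
  ∀ ε, 0 < ε → ε ≤ 1 / 4 → ∃ δ, 0 < δ ∧ δ ≤ ε ∧ ∀ (α : (ι → ℝ) → X) (β : (ι → ℝ) → Y),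
    StrictDatum φ ε α β → StrictSolvable φ δ α β

/-- Filling the open box extends `h` to a homotopy `F` over the cube, and `α` with `F t 1` is a
strict problem. Unwinding the stationary homotopy at `F t 1` back to `F`, with `α` fixed, is a
homotopy of lifting problems, so solvability transfers. -/
theorem StrictLiftProp.liftProp (hφ : DSmooth φ) (hL : StrictLiftProp ι φ) : LiftProp ι φ := by
  intro ε hε hε'
  set δ := ε / 4 with hδ
  have hδ0 : 0 < δ := by positivity
  have hδ' : δ ≤ 1 / 4 := by linarith
  obtain ⟨η, hη, hηδ, hL⟩ := hL δ hδ0 hδ'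
  refine ⟨η / 4, by positivity, by linarith, fun α h D => ?_⟩
  obtain ⟨F, F1, F2, F3, F4⟩ := exists_fill hε hε' D.tame₂ D.smooth₂
  have F1' : Tame₂ δ F := F1.mono hδ0 (by linarith) (by linarith)
  have hα : Tame δ α := D.tame.mono hδ0 hε' (by linarith)
  have htop : ∀ t ∈ col ι δ, F t 1 = φ (α t) := fun t ht => by
    rw [F3 t (col_mono (by linarith) ht), D.top t (col_mono (by linarith) ht)]
  have hstr : StrictDatum φ δ α (fun t => F t 1) :=
    ⟨hα, F1'.left hδ0 hδ' 1, D.smooth.mono (col_mono (by linarith)),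
      F2.comp (g := fun t => (t, (1 : ℝ))) (contDiff_id.prodMk contDiff_const) (mapsTo_univ _ _),
      htop⟩
  obtain ⟨α₀, H₀, S⟩ := hL α _ hstr
  have hη4 : η ≤ 1 / 4 := by linarith
  have hsg : ∀ s, sg (ε / 2) (kap η s) = sg (ε / 2) s :=
    sg_kap hη (by linarith) (by linarith)
  have hs0 : sg (ε / 2) 0 = 0 := sg_zero (by linarith) (by linarith)
  have hs1 : sg (ε / 2) 1 = 1 := sg_one (by linarith) (by linarith)
  -- The time parameter of `F` is `1` for `s = 0`, is `sg (ε / 2) τ` for `s = 1`, and is `1` at `τ =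
  -- 1` for all `s`, which preserves the condition at the top.
  obtain ⟨α₁, H₁, S₁⟩ := LiftSolution.transfer hη hη4 hφ (α := fun t _ => α t)
    (h := fun t τ s => F t (1 - sg (ε / 2) s * (1 - sg (ε / 2) τ)))
    (fun t s => hα.mono hη hδ' hηδ t)
    (fun t τ s => by
      rw [hsg, hsg]
      exact (F1'.mono hη hδ' hηδ).left hη hη4 _ t)
    ((D.smooth.mono (col_mono (by linarith))).comp (g := Prod.fst) contDiff_fst fun p hp => hp)
    ((F2.comp (g := fun p : (ι → ℝ) × ℝ × ℝ =>
        (p.1, 1 - sg (ε / 2) p.2.2 * (1 - sg (ε / 2) p.2.1)))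
      (contDiff_fst.prodMk (contDiff_const.sub (((contDiff_sg _).comp
        (contDiff_snd.comp contDiff_snd)).mul (contDiff_const.sub ((contDiff_sg _).comp
          (contDiff_fst.comp contDiff_snd)))))) (mapsTo_univ _ univ)).mono (subset_univ _))
    (fun t ht s => by
      rw [hs1, sub_self, mul_zero, sub_zero, htop t (col_mono hηδ ht)])
    (α₀ := α₀) (H₀ := H₀) (by
      simpa only [hs0, zero_mul, sub_zero] using S)
  have hF : ∀ t τ, F t (1 - sg (ε / 2) 1 * (1 - sg (ε / 2) τ)) = F t τ := fun t τ => by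
    rw [hs1, one_mul, sub_sub_cancel, F1.sg (by linarith) (by linarith)]
  simp only [hF] at S₁
  refine ⟨α₁, H₁, S₁.tame, S₁.tame₂, S₁.smooth, S₁.smooth₂, S₁.eq, fun t ht s => ?_,
    fun t => ?_, S₁.one⟩
  · rw [S₁.eq₂ t ht, F3 t (col_mono (by linarith) ht)]
  · rw [S₁.zero, F4]

/-- A strict lifting problem may be deformed along a homotopy of its boundary map. -/
theorem StrictDatum.deform (hε : 0 < ε) (hε' : ε ≤ 1 / 4) (hφ : DSmooth φ)
    {α : (ι → ℝ) → X} {β : (ι → ℝ) → Y} (D : StrictDatum φ ε α β) {a : (ι → ℝ) → ℝ → X}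
    (ha : Tame₂ ε a) (sa : PlotOn (fun p : (ι → ℝ) × ℝ => a p.1 p.2) {p | p.1 ∈ col ι ε})
    (h : ∀ t ∈ col ι ε, a t 1 = α t) :
    ∃ β₀, StrictDatum φ (ε / 2) (fun t => a t 0) β₀ ∧
      ∀ η, 0 < η → η ≤ ε / 2 → StrictSolvable φ η (fun t => a t 0) β₀ →
        StrictSolvable φ (η / 4) α β := by
  obtain ⟨B, B1, B2, B3, B4⟩ := exists_homotopy_ext_one hε hε' (g := fun t s => φ (a t s)) D.tame'
    (fun t s => congrArg φ (ha t s)) D.smooth' (sa.dsmooth_comp hφ)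
    (fun t ht => by rw [h t ht, D.comm t ht])
  have hε2 : 0 < ε / 2 := by positivity
  refine ⟨fun t => B t 0, ⟨(ha.left hε hε' 0).mono hε2 hε' (by linarith),
    B1.left hε2 (by linarith) 0, ?_, ?_, fun t ht => B3 t ht 0⟩, fun η hη hηε ⟨α₀, H₀, S⟩ => ?_⟩
  · exact sa.comp (g := fun t => (t, (0 : ℝ))) (contDiff_id.prodMk contDiff_const)
      (fun t ht => col_mono (by linarith) ht)
  · exact B2.comp (g := fun t => (t, (0 : ℝ))) (contDiff_id.prodMk contDiff_const)
      (mapsTo_univ _ _)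
  · have B1' : Tame₂ η B := B1.mono hη (by linarith) hηε
    -- The problems with boundary map `a t s` and homotopy stationary at `B t s` interpolate between
    -- the deformed problem and the given one.
    obtain ⟨α₁, H₁, S₁⟩ := LiftSolution.transfer hη (by linarith) hφ (α := a)
      (h := fun t _ s => B t s) (ha.mono hη hε' (by linarith)) (fun t _ s => B1' t s)
      (sa.mono fun p hp => col_mono (by linarith) hp)
      ((B2.comp (g := fun p : (ι → ℝ) × ℝ × ℝ => (p.1, p.2.2))
        (contDiff_fst.prodMk (contDiff_snd.comp contDiff_snd))
        (mapsTo_univ _ univ)).mono (subset_univ _))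
      (fun t ht s => B3 t (col_mono hηε ht) s) S
    refine ⟨α₁, H₁, S₁.tame, S₁.tame₂, S₁.smooth, S₁.smooth₂, fun t ht => ?_, fun t ht s => ?_,
      fun t => ?_, S₁.one⟩
    · rw [S₁.eq t ht, h t (col_mono (by linarith) ht)]
    · rw [S₁.eq₂ t ht, B4]
    · rw [S₁.zero, B4]

end Lifting

/-! ### Homotopy and smooth paths as equivalence relations -/

section Relations

variable {X Y : Type*} [DiffeologicalSpace X] [DiffeologicalSpace Y]

theorem isPlot_subtype {A : Set X} {n : ℕ} {p : EuclideanSpace ℝ (Fin n) → A} :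
    IsPlot p ↔ IsPlot (fun r => (p r : X)) := Iff.rfl

theorem isPlot_prod {n : ℕ} {p : EuclideanSpace ℝ (Fin n) → X × Y} :
    IsPlot p ↔ IsPlot (fun r => (p r).1) ∧ IsPlot (fun r => (p r).2) := Iff.rfl

theorem dSmooth_val (A : Set X) : DSmooth (Subtype.val : A → X) := fun _ _ hp => hp

theorem DSmooth.prodMk {Z : Type*} [DiffeologicalSpace Z] {f : Z → X} {g : Z → Y}
    (hf : DSmooth f) (hg : DSmooth g) : DSmooth (fun z => (f z, g z)) :=
  fun n p hp => ⟨hf n p hp, hg n p hp⟩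

theorem dSmooth_fst : DSmooth (Prod.fst : X × Y → X) := fun _ _ hp => hp.1

theorem dSmooth_snd : DSmooth (Prod.snd : X × Y → Y) := fun _ _ hp => hp.2

/-- A smooth real function with values in the unit interval, as a map to the unit interval. -/
theorem dSmooth_unitInterval {f : ℝ → ℝ} (hf : ContDiff ℝ ∞ f) (h : ∀ s, f s ∈ unitInterval)
    {n : ℕ} {p : EuclideanSpace ℝ (Fin n) → unitInterval} (hp : IsPlot p) :
    IsPlot (fun r => (⟨f (p r), h _⟩ : unitInterval)) := by
  rw [isPlot_subtype] at hp ⊢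
  exact (hf.comp hp.contDiff).isPlot

/-- Concatenation of smooth homotopies. -/
theorem exists_concat {F G : X × unitInterval → Y} (hF : DSmooth F) (hG : DSmooth G)
    (h : ∀ x, F (x, 1) = G (x, 0)) : ∃ K : X × unitInterval → Y, DSmooth K ∧
      (∀ x, K (x, 0) = F (x, 0)) ∧ (∀ x, K (x, 1) = G (x, 1)) ∧
      ∀ x t, ∃ s, K (x, t) = F (x, s) ∨ K (x, t) = G (x, s) := by
  have ha : ∀ s, Real.smoothTransition (3 * s) ∈ unitInterval := fun s =>
    ⟨Real.smoothTransition.nonneg _, Real.smoothTransition.le_one _⟩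
  have hb : ∀ s, Real.smoothTransition (3 * s - 2) ∈ unitInterval := fun s =>
    ⟨Real.smoothTransition.nonneg _, Real.smoothTransition.le_one _⟩
  have ha' : ContDiff ℝ ∞ fun s : ℝ => Real.smoothTransition (3 * s) :=
    Real.smoothTransition.contDiff.comp (contDiff_const.mul contDiff_id)
  have hb' : ContDiff ℝ ∞ fun s : ℝ => Real.smoothTransition (3 * s - 2) :=
    Real.smoothTransition.contDiff.comp ((contDiff_const.mul contDiff_id).sub contDiff_const)
  -- Both reparametrized homotopies rest at the common map for times in `[1/3, 2/3]`, so each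
  -- formula is valid on one of two overlapping open sets.
  set K : X × unitInterval → Y := fun q => if (q.2 : ℝ) < 1 / 2
    then F (q.1, ⟨Real.smoothTransition (3 * (q.2 : ℝ)), ha _⟩)
    else G (q.1, ⟨Real.smoothTransition (3 * (q.2 : ℝ) - 2), hb _⟩) with hK
  have hmid1 : ∀ q : X × unitInterval, (q.2 : ℝ) < 2 / 3 →
      K q = F (q.1, ⟨Real.smoothTransition (3 * (q.2 : ℝ)), ha _⟩) := by
    intro q hq
    by_cases h2 : (q.2 : ℝ) < 1 / 2
    · exact if_pos h2
    · have e1 : (⟨Real.smoothTransition (3 * (q.2 : ℝ)), ha _⟩ : unitInterval) = 1 :=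
        Subtype.ext (Real.smoothTransition.one_of_one_le (by linarith))
      have e2 : (⟨Real.smoothTransition (3 * (q.2 : ℝ) - 2), hb _⟩ : unitInterval) = 0 :=
        Subtype.ext (Real.smoothTransition.zero_of_nonpos (by linarith))
      rw [e1, h, ← e2]
      exact if_neg h2
  have hmid2 : ∀ q : X × unitInterval, 1 / 3 < (q.2 : ℝ) →
      K q = G (q.1, ⟨Real.smoothTransition (3 * (q.2 : ℝ) - 2), hb _⟩) := by
    intro q hq
    by_cases h2 : (q.2 : ℝ) < 1 / 2
    · have e1 : (⟨Real.smoothTransition (3 * (q.2 : ℝ)), ha _⟩ : unitInterval) = 1 :=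
        Subtype.ext (Real.smoothTransition.one_of_one_le (by linarith))
      have e2 : (⟨Real.smoothTransition (3 * (q.2 : ℝ) - 2), hb _⟩ : unitInterval) = 0 :=
        Subtype.ext (Real.smoothTransition.zero_of_nonpos (by linarith))
      rw [e2, ← h, ← e1]
      exact if_pos h2
    · exact if_neg h2
  refine ⟨K, ?_, fun x => ?_, fun x => ?_, fun x t => ?_⟩
  · intro n p hp
    refine DiffeologicalSpace.locality (p := K ∘ p) fun r => ?_
    have hc : Continuous fun r => ((p r).2 : ℝ) := (isPlot_subtype.1 hp.2).contDiff.continuous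
    rcases lt_or_ge ((p r).2 : ℝ) (2 / 3) with hr | hr
    · refine ⟨{r | ((p r).2 : ℝ) < 2 / 3}, isOpen_lt hc continuous_const, hr,
        fun {m f} hf hf' => ?_⟩
      have hp' : IsPlot (p ∘ f) := isPlot_reparam hp hf'
      have : IsPlot (F ∘ fun r => ((p (f r)).1,
          (⟨Real.smoothTransition (3 * ((p (f r)).2 : ℝ)), ha _⟩ :
          unitInterval))) :=
        hF _ _ (isPlot_prod.2 ⟨hp'.1, dSmooth_unitInterval ha' ha hp'.2⟩)
      refine (congrArg IsPlot (funext fun z => ?_)).mp this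
      exact (hmid1 _ (hf z)).symm
    · refine ⟨{r | 1 / 3 < ((p r).2 : ℝ)}, isOpen_lt continuous_const hc,
        lt_of_lt_of_le (by norm_num) hr, fun {m f} hf hf' => ?_⟩
      have hp' : IsPlot (p ∘ f) := isPlot_reparam hp hf'
      have : IsPlot (G ∘ fun r => ((p (f r)).1,
          (⟨Real.smoothTransition (3 * ((p (f r)).2 : ℝ) - 2), hb _⟩ :
          unitInterval))) :=
        hG _ _ (isPlot_prod.2 ⟨hp'.1, dSmooth_unitInterval hb' hb hp'.2⟩)
      refine (congrArg IsPlot (funext fun z => ?_)).mp this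
      exact (hmid2 _ (hf z)).symm
  · rw [hmid1 _ (by norm_num)]
    congr
    norm_num
  · rw [hmid2 _ (by norm_num)]
    congr
    exact Real.smoothTransition.one_of_one_le (by norm_num)
  · by_cases h2 : (t : ℝ) < 1 / 2
    · exact ⟨_, Or.inl (if_pos h2)⟩
    · exact ⟨_, Or.inr (if_neg h2)⟩

theorem dSmooth_symm : DSmooth (unitInterval.symm : unitInterval → unitInterval) := fun _ _ hp =>
  (contDiff_const.sub (isPlot_subtype.1 hp).contDiff).isPlot

/-- Needed because equality in a `Quot` only yields a chain of homotopies; here the chain reduces to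
a single one. -/
theorem pairHomotopic_equivalence (A : Set X) (B : Set Y) :
    Equivalence (PairHomotopic (A := A) (B := B)) where
  refl f := ⟨fun q => f.1 q.1, f.2.1.comp dSmooth_fst, fun _ => rfl, fun _ => rfl,
    fun a ha _ => f.2.2 ha⟩
  symm := by
    rintro f g ⟨F, hF, h0, h1, hA⟩
    refine ⟨fun q => F (q.1, unitInterval.symm q.2),
      hF.comp (dSmooth_fst.prodMk (dSmooth_symm.comp dSmooth_snd)), fun x => ?_, fun x => ?_,
      fun a ha t => hA a ha _⟩
    · rw [← h1]; simp
    · rw [← h0]; simp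
  trans := by
    rintro f g k ⟨F, hF, h0, h1, hA⟩ ⟨G, hG, k0, k1, kA⟩
    obtain ⟨K, hK, e0, e1, eA⟩ := exists_concat hF hG fun x => by rw [h1, k0]
    refine ⟨K, hK, fun x => by rw [e0, h0], fun x => by rw [e1, k1], fun a ha t => ?_⟩
    obtain ⟨s, hs | hs⟩ := eA a t <;> rw [hs]
    · exact hA a ha s
    · exact kA a ha s

theorem pairHomotopic_of_eq {A : Set X} {B : Set Y} {f g : PairMap A B}
    (h : (Quot.mk _ f : PairHomotopyClasses A B) = Quot.mk _ g) : PairHomotopic f g := by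
  have := Quot.eqvGen_exact h
  rwa [(pairHomotopic_equivalence A B).eqvGen_iff] at this

theorem smoothlyJoined_equivalence : Equivalence (SmoothlyJoined (X := X)) where
  refl x := ⟨fun _ => x, dSmooth_const, rfl, rfl⟩
  symm := by
    rintro x y ⟨γ, hγ, h0, h1⟩
    exact ⟨γ ∘ unitInterval.symm, hγ.comp dSmooth_symm, by simp [h1], by simp [h0]⟩
  trans := by
    rintro x y z ⟨γ, hγ, h0, h1⟩ ⟨η, hη, k0, k1⟩
    obtain ⟨K, hK, e0, e1, -⟩ := exists_concat (X := unitInterval) (hγ.comp dSmooth_snd)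
      (hη.comp dSmooth_snd) fun _ => h1.trans k0.symm
    exact ⟨fun t => K (0, t), hK.comp (dSmooth_const.prodMk dSmooth_id), (e0 0).trans h0,
      (e1 0).trans k1⟩

theorem smoothlyJoined_of_eq {x y : X} (h : (Quot.mk _ x : PathComponents X) = Quot.mk _ y) :
    SmoothlyJoined x y := by
  have := Quot.eqvGen_exact h
  rwa [smoothlyJoined_equivalence.eqvGen_iff] at this

end Relations

/-! ### Standard cubes versus tame maps on `ι → ℝ` -/

section Cubes

variable {ι X : Type*} {k : ℕ} {ε δ : ℝ}

theorem quarter_pos : (0 : ℝ) < 1 / 4 := by norm_num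

/-- The smooth clamping map to the unit interval. -/
noncomputable def sgI (s : ℝ) : unitInterval := ⟨sg (1 / 4) s, sg_mem quarter_pos le_rfl s⟩

/-- The smooth clamping map to the standard cube. -/
noncomputable def toCube (e : ι ≃ Fin k) (t : ι → ℝ) : cube k :=
  ⟨WithLp.toLp 2 fun j => sg (1 / 4) (t (e.symm j)), fun _ => sg_mem quarter_pos le_rfl _⟩

/-- The coordinates of a point of the standard cube. -/
def fromCube (e : ι ≃ Fin k) (z : cube k) : ι → ℝ := fun i => (z : EuclideanSpace ℝ (Fin k)) (e i)

theorem fromCube_toCube (e : ι ≃ Fin k) (t : ι → ℝ) : fromCube e (toCube e t) = sgv (1 / 4) t := by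
  funext i
  simp [fromCube, toCube, sgv]

theorem toCube_kapv (e : ι ≃ Fin k) (hδ : 0 < δ) (hδ' : δ ≤ 1 / 8) (t : ι → ℝ) :
    toCube e (kapv δ t) = toCube e t := by
  have := sgv_kapv (ι := ι) hδ (show δ ≤ 1 / 4 / 2 by linarith) le_rfl t
  exact Subtype.ext (congrArg (WithLp.toLp 2) (funext fun j => congrFun this (e.symm j)))

theorem sgI_kap (hδ : 0 < δ) (hδ' : δ ≤ 1 / 8) (s : ℝ) : sgI (kap δ s) = sgI s :=
  Subtype.ext (sg_kap hδ (by linarith) le_rfl s)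

theorem toCube_mem_boundary (e : ι ≃ Fin k) {t : ι → ℝ} (hδ : δ ≤ 1 / 8) (h : t ∈ col ι δ) :
    toCube e t ∈ cubeBoundary k := by
  obtain ⟨i, hi⟩ := h
  refine ⟨e i, hi.imp (fun h => ?_) (fun h => ?_)⟩
  · simp only [toCube, Equiv.symm_apply_apply]
    exact sg_of_le quarter_pos le_rfl (by linarith)
  · simp only [toCube, Equiv.symm_apply_apply]
    exact sg_of_ge quarter_pos le_rfl (by linarith)

theorem fromCube_boundary (e : ι ≃ Fin k) {z : cube k} (h : z ∈ cubeBoundary k) :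
    ∃ i, fromCube e z i = 0 ∨ fromCube e z i = 1 := by
  obtain ⟨j, hj⟩ := h
  exact ⟨e.symm j, by simpa [fromCube] using hj⟩

theorem mem_col_of_boundary (hε : 0 < ε) {t : ι → ℝ} (h : ∃ i, t i = 0 ∨ t i = 1) :
    t ∈ col ι ε := by
  obtain ⟨i, hi⟩ := h
  exact ⟨i, hi.imp (fun h => by linarith) (fun h => by linarith)⟩

variable [Fintype ι] [DiffeologicalSpace X]

theorem contDiff_toCube (e : ι ≃ Fin k) :
    ContDiff ℝ ∞ fun t : ι → ℝ => (toCube e t : EuclideanSpace ℝ (Fin k)) :=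
  (contDiff_piLp 2).2 fun j => (contDiff_sg _).comp (contDiff_apply ℝ ℝ (e.symm j))

theorem contDiff_fromCube (e : ι ≃ Fin k) :
    ContDiff ℝ ∞ fun (z : EuclideanSpace ℝ (Fin k)) (i : ι) => z (e i) :=
  contDiff_pi.2 fun i => (contDiff_piLp 2).1 contDiff_id (e i)

theorem DSmooth.plotOn_toCube (e : ι ≃ Fin k) {f : cube k → X} (hf : DSmooth f) :
    PlotOn (fun t => f (toCube e t)) univ := fun _ p hp _ =>
  hf _ (fun r => toCube e (p r)) (isPlot_subtype.2 ((contDiff_toCube e).comp hp).isPlot)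

theorem DSmooth.plotOn_toCube_prod (e : ι ≃ Fin k) {f : cube k × unitInterval → X}
    (hf : DSmooth f) :
    PlotOn (fun p : (ι → ℝ) × ℝ => f (toCube e p.1, sgI p.2)) univ := fun _ p hp _ =>
  hf _ (fun r => (toCube e (p r).1, sgI (p r).2))
    ⟨((contDiff_toCube e).comp (contDiff_fst.comp hp)).isPlot,
      ((contDiff_sg (1 / 4)).comp (contDiff_snd.comp hp)).isPlot⟩

theorem PlotOn.dSmooth_fromCube (e : ι ≃ Fin k) {f : (ι → ℝ) → X} (hf : PlotOn f univ) :
    DSmooth fun z => f (fromCube e z) := fun _ p hp =>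
  hf (fun r => fromCube e (p r)) ((contDiff_fromCube e).comp (isPlot_subtype.1 hp).contDiff)
    fun _ => mem_univ _

theorem PlotOn.dSmooth_fromCube_prod (e : ι ≃ Fin k) {f : (ι → ℝ) × ℝ → X} (hf : PlotOn f univ) :
    DSmooth fun q : cube k × unitInterval => f (fromCube e q.1, (q.2 : ℝ)) := fun _ p hp =>
  hf (fun r => (fromCube e (p r).1, ((p r).2 : ℝ)))
    (((contDiff_fromCube e).comp (isPlot_subtype.1 hp.1).contDiff).prodMk
      (isPlot_subtype.1 hp.2).contDiff) fun _ => mem_univ _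

/-- The pair map of a tame map that is constant on the collar. -/
def PairMap.ofTame (e : ι ≃ Fin k) (hε : 0 < ε) {a : (ι → ℝ) → X} (ha : PlotOn a univ) {x : X}
    (h : ∀ t ∈ col ι ε, a t = x) : PairMap (cubeBoundary k) ({x} : Set X) :=
  ⟨fun z => a (fromCube e z), ha.dSmooth_fromCube e,
    fun _ hz => h _ (mem_col_of_boundary hε (fromCube_boundary e hz))⟩

open Classical in
/-- A smooth homotopy starting at a tame map can be made tame, keeping its starting map. -/
theorem exists_tame_homotopy (e : ι ≃ Fin k) (hδ : 0 < δ) (hδε : δ ≤ ε / 2) (hδ' : δ ≤ 1 / 8)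
    (hε' : ε ≤ 1 / 4) {x : X} {a : (ι → ℝ) → X} (ha : Tame ε a) (sa : PlotOn a univ)
    (hx : ∀ t ∈ col ι ε, a t = x) {F : cube k × unitInterval → X} (hF : DSmooth F)
    (h0 : ∀ z, F (z, 0) = a (fromCube e z)) (hA : ∀ z ∈ cubeBoundary k, ∀ s, F (z, s) = x) :
    ∃ K : (ι → ℝ) → ℝ → X, Tame₂ (δ / 2) K ∧ PlotOn (fun p : (ι → ℝ) × ℝ => K p.1 p.2) univ ∧
      (∀ t, K t 0 = a t) ∧ (∀ t, K t 1 = F (toCube e t, 1)) ∧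
      ∀ t ∈ col ι (δ / 2), ∀ s, K t s = x := by
  have hε : 0 < ε := by linarith
  have hδ4 : δ ≤ 1 / 4 := by linarith
  have hT := toCube_kapv e hδ hδ'
  have hI := sgI_kap hδ hδ'
  have hI0 : ∀ s, s < δ → sgI s = 0 := fun s hs =>
    Subtype.ext (sg_of_le quarter_pos le_rfl (by linarith))
  have hI1 : ∀ s, 1 - δ < s → sgI s = 1 := fun s hs =>
    Subtype.ext (sg_of_ge quarter_pos le_rfl (by linarith))
  -- `F (toCube e t, sgI s)` is tame but starts at `a ∘ sgv (1 / 4)` instead of `a`. The segment `m`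
  -- leads from `sgv (1 / 4)` to `sgv ε`, where `a ∘ sgv ε = a`, and `a` stays equal to `x` along it
  -- over the collar. Below, this correction is applied at the bottom of the homotopy, with sides
  -- and top fixed.
  set m : (ι → ℝ) → ℝ → ι → ℝ := fun t s =>
    (1 - sg (1 / 4) s) • sgv (1 / 4) t + sg (1 / 4) s • sgv ε t with hm
  have hmk : ∀ t s, m (kapv δ t) (kap δ s) = m t s := fun t s => by
    simp only [hm]
    rw [sgv_kapv hδ (by linarith) le_rfl, sgv_kapv hδ hδε hε', sg_kap hδ (by linarith) le_rfl]
  have hmc : ∀ t ∈ col ι δ, ∀ s, a (m t s) = x := by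
    rintro t ⟨i, hi⟩ s
    refine hx _ ⟨i, hi.imp (fun h => ?_) (fun h => ?_)⟩
    · simp only [hm, Pi.add_apply, Pi.smul_apply, smul_eq_mul, sgv]
      rw [sg_of_le (s := t i) quarter_pos le_rfl (by linarith), sg_of_le hε hε' (by linarith)]
      linarith
    · simp only [hm, Pi.add_apply, Pi.smul_apply, smul_eq_mul, sgv]
      rw [sg_of_ge (s := t i) quarter_pos le_rfl (by linarith), sg_of_ge hε hε' (by linarith)]
      linarith
  have hms : ContDiff ℝ ∞ fun p : (ι → ℝ) × ℝ => m p.1 p.2 :=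
    ((contDiff_const.sub ((contDiff_sg _).comp contDiff_snd)).smul
      ((contDiff_sgv _).comp contDiff_fst)).add
      (((contDiff_sg _).comp contDiff_snd).smul ((contDiff_sgv _).comp contDiff_fst))
  have hFx : ∀ t ∈ col ι δ, ∀ s, F (toCube e t, s) = x := fun t ht s =>
    hA _ (toCube_mem_boundary e hδ' ht) s
  set g : (Option ι → ℝ) → ℝ → X := fun u s => if u none < δ then a (m (otail u) s) else
    if 1 - δ < u none then F (toCube e (otail u), 1) else x with hg
  have hg0 : ∀ u s, u none < δ → g u s = a (m (otail u) s) := fun u s h => if_pos h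
  have hg1 : ∀ u s, 1 - δ < u none → g u s = F (toCube e (otail u), 1) := fun u s h => by
    simp only [hg]; rw [if_neg (by linarith), if_pos h]
  have hgx : ∀ u s, otail u ∈ col ι δ → g u s = x := fun u s h => by
    simp only [hg, hmc _ h, hFx _ h, ite_self]
  obtain ⟨G, G1, G2, G3, G4⟩ := exists_homotopy_ext (ι := Option ι) hδ hδ4
    (g₀ := fun u => F (toCube e (otail u), sgI (u none))) (g := g)
    (fun u => by simp only [otail_kapv, kapv_none, hT, hI])
    (fun u s => by
      simp only [hg, otail_kapv, kapv_none, kap_lt_iff hδ hδ4 le_rfl, lt_kap_iff hδ hδ4 le_rfl,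
        hT, hmk])
    ((hF.plotOn_toCube_prod e).comp (g := fun u : Option ι → ℝ => (otail u, u none))
      (contDiff_otail.prodMk (contDiff_apply ℝ ℝ none)) (mapsTo_univ _ _))
    (by
      have c1 : Continuous fun p : (Option ι → ℝ) × ℝ => otail p.1 :=
        contDiff_otail.continuous.comp continuous_fst
      have c2 : Continuous fun p : (Option ι → ℝ) × ℝ => p.1 none :=
        (continuous_apply none).comp continuous_fst
      refine PlotOn.mono (U := ({p : (Option ι → ℝ) × ℝ | otail p.1 ∈ col ι δ} ∪
        {p | p.1 none < δ}) ∪ {p | 1 - δ < p.1 none}) (PlotOn.union ?_ ?_ (PlotOn.union ?_ ?_ ?_ ?_)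
          ?_) (fun p hp => mem_col_option.1 hp)
      · exact ((isOpen_col δ).preimage c1).union (isOpen_lt c2 continuous_const)
      · exact isOpen_lt continuous_const c2
      · exact (isOpen_col δ).preimage c1
      · exact isOpen_lt c2 continuous_const
      · exact (plotOn_const x _).congr fun p hp => hgx _ _ hp
      · exact (sa.comp (hms.comp ((contDiff_otail.comp contDiff_fst).prodMk contDiff_snd))
          (mapsTo_univ _ _)).congr fun p hp => hg0 _ _ hp
      · exact ((DSmooth.plotOn_toCube (f := fun z => F (z, 1)) e
          (hF.comp (dSmooth_id.prodMk dSmooth_const))).comp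
          (contDiff_otail.comp contDiff_fst) (mapsTo_univ _ _)).congr fun p hp => hg1 _ _ hp)
    (fun u hu => by
      rw [mem_col_option] at hu
      rcases hu with (hu | hu) | hu
      · rw [hgx _ _ hu, hFx _ hu]
      · rw [hg0 _ _ hu, hI0 _ hu, h0, fromCube_toCube]
        simp only [hm, sg_zero quarter_pos le_rfl, sub_zero, one_smul, zero_smul, add_zero]
      · rw [hg1 _ _ hu, hI1 _ hu])
  refine ⟨fun t τ => G (ocons t τ) 1, fun t τ => ?_, ?_, fun t => ?_, fun t => ?_,
    fun t ht s => ?_⟩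
  · beta_reduce
    rw [← kapv_ocons]
    exact G1.left (by linarith) (by linarith) 1 _
  · exact G2.comp (g := fun p : (ι → ℝ) × ℝ => (ocons p.1 p.2, (1 : ℝ)))
      (contDiff_ocons.prodMk contDiff_const) (mapsTo_univ _ _)
  · beta_reduce
    rw [G3 _ (mem_col_option.2 (Or.inl (Or.inr (by rw [ocons_none]; positivity)))),
      hg0 _ _ (by rw [ocons_none]; positivity), otail_ocons]
    simp only [hm, sg_one quarter_pos le_rfl, sub_self, one_smul, zero_smul, zero_add]
    exact ha.sgv hε hε' t
  · beta_reduce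
    rw [G3 _ (mem_col_option.2 (Or.inr (by rw [ocons_none]; linarith))),
      hg1 _ _ (by rw [ocons_none]; linarith), otail_ocons]
  · beta_reduce
    rw [G3 _ (mem_col_option.2 (Or.inl (Or.inl (by rwa [otail_ocons])))),
      hgx _ _ (by rw [otail_ocons]; exact col_mono (by linarith) ht)]

end Cubes

/-! ### Weak equivalences solve lifting problems -/

section WeakEquivalence

variable {ι X Y : Type*} [DiffeologicalSpace X] [DiffeologicalSpace Y] {φ : X → Y}
  {k : ℕ} {ε δ : ℝ}

theorem sgI_zero : sgI 0 = 0 := Subtype.ext (sg_zero quarter_pos le_rfl)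

theorem sgI_one : sgI 1 = 1 := Subtype.ext (sg_one quarter_pos le_rfl)

variable [Fintype ι]

theorem StrictDatum.mono {α : (ι → ℝ) → X} {β : (ι → ℝ) → Y} (D : StrictDatum φ ε α β)
    (hδ : 0 < δ) (hε : ε ≤ 1 / 4) (hle : δ ≤ ε) : StrictDatum φ δ α β where
  tame := D.tame.mono hδ hε hle
  tame' := D.tame'.mono hδ hε hle
  smooth := D.smooth.mono (col_mono hle)
  smooth' := D.smooth'
  comm t ht := D.comm t (col_mono hle ht)

/-- A cube of dimension 0 has no boundary: the problem is a point of `Y`, and a solution is a path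
from it to a point in the image of `φ`. -/
theorem strictLiftProp_of_isEmpty [IsEmpty ι] (hφ : DSmooth φ)
    (h : Function.Surjective (PathComponents.map φ hφ)) : StrictLiftProp ι φ := by
  intro ε hε hε'
  refine ⟨min ε (1 / 8), by positivity, min_le_left _ _, fun α β D => ?_⟩
  obtain ⟨q, hq⟩ := h (Quot.mk _ (β 0))
  obtain ⟨x, rfl⟩ := Quot.exists_rep q
  obtain ⟨γ, hγ, h0, h1⟩ := smoothlyJoined_of_eq (y := φ x) hq.symm
  refine ⟨fun _ => x, fun _ s => γ (sgI s), fun _ => rfl, fun t s => ?_, plotOn_const _ _, ?_,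
    fun t ⟨i, _⟩ => isEmptyElim i, fun t ⟨i, _⟩ => isEmptyElim i, fun t => ?_, fun t => ?_⟩
  · rw [sgI_kap (by positivity) (min_le_right _ _)]
  · exact fun n p hp _ => hγ n (fun r => sgI (p r).2)
      ((contDiff_sg (1 / 4)).comp (contDiff_snd.comp hp)).isPlot
  · rw [sgI_zero, h0, Subsingleton.elim t 0]
  · rw [sgI_one, h1]

/-- With constant boundary value, `β` represents a class in `π_k(Y, φ x)`. A representative of a
preimage is the lift, and the homotopy between the two, made tame, is `H`. -/
theorem StrictDatum.solvable_of_const (e : ι ≃ Fin k) (hε : 0 < ε) (hε' : ε ≤ 1 / 4)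
    (hφ : DSmooth φ) {x : X} (surj : Function.Surjective (HomotopySet.map k φ hφ x))
    {β : (ι → ℝ) → Y} (D : StrictDatum φ ε (fun _ => x) β) :
    StrictSolvable φ (ε / 8) (fun _ => x) β := by
  obtain ⟨q, hq⟩ := surj (Quot.mk _ (PairMap.ofTame e hε D.smooth' D.comm))
  obtain ⟨γ, rfl⟩ := Quot.exists_rep q
  obtain ⟨F, hF, h0, h1, hA⟩ := pairHomotopic_of_eq hq.symm
  obtain ⟨K, K1, K2, K3, K4, K5⟩ := exists_tame_homotopy e (δ := ε / 4) (by positivity)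
    (by linarith) (by linarith) hε' D.tame' D.smooth' D.comm hF h0 hA
  have h8 : ε / 4 / 2 = ε / 8 := by ring
  rw [h8] at K1 K5
  refine ⟨fun t => γ.1 (toCube e t), K, fun t => ?_, K1, γ.2.1.plotOn_toCube e, K2, fun t ht => ?_,
    fun t ht s => ?_, K3, fun t => ?_⟩
  · rw [toCube_kapv e (by positivity) (by linarith)]
  · exact γ.2.2 (toCube_mem_boundary e (by linarith) ht)
  · rw [K5 t ht, D.comm t (col_mono (by linarith) ht)]
  · rw [K4, h1]; rfl

/-- An extension `g` of `α` over the cube contracts the boundary map to the constant `g 0` along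
rays to the origin; deforming the problem along this contraction reduces it to a constant boundary
value. -/
theorem StrictDatum.solvable_of_extends (e : ι ≃ Fin k) (hε : 0 < ε) (hε' : ε ≤ 1 / 4)
    (hφ : DSmooth φ) (surj : ∀ x, Function.Surjective (HomotopySet.map k φ hφ x))
    {α : (ι → ℝ) → X} {β : (ι → ℝ) → Y} (D : StrictDatum φ ε α β) {g : (ι → ℝ) → X}
    (hg : Tame ε g) (sg' : PlotOn g univ) (hα : ∀ t ∈ col ι ε, g t = α t) :
    StrictSolvable φ (ε / 128) α β := by
  obtain ⟨β₀, D₀, h⟩ := (D.mono (half_pos hε) hε' (by linarith)).deform (half_pos hε) (by linarith)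
    hφ (a := fun t s => g (sg (1 / 4) s • sgv ε t))
    (fun t s => by
      beta_reduce
      rw [sg_kap (half_pos hε) (by linarith) le_rfl, sgv_kapv (half_pos hε) le_rfl hε'])
    ((sg'.comp (g := fun p : (ι → ℝ) × ℝ => sg (1 / 4) p.2 • sgv ε p.1)
      (((contDiff_sg _).comp contDiff_snd).smul ((contDiff_sgv _).comp contDiff_fst))
      (mapsTo_univ _ univ)).mono (subset_univ _))
    (fun t ht => by
      rw [sg_one quarter_pos le_rfl, one_smul, hg.sgv hε hε', hα t (col_mono (by linarith) ht)])
  simp only [sg_zero quarter_pos le_rfl, zero_smul] at D₀ h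
  have S := D₀.solvable_of_const e (by positivity) (by linarith) hφ (surj _)
  have := h (ε / 2 / 2 / 8) (by positivity) (by linarith) S
  convert this using 1
  ring

open Classical in
-- The open box in the boundary of `I^k × I` is contractible, so the boundary map deforms to one
-- that is constant `x` there and is a `k`-sphere `K t 0` on the top. The deformed `β₀` is a null
-- homotopy of its image in `Y`; by injectivity on `π_k` the sphere is null homotopic in `X`. Hence
-- the boundary map extends over the cube, and surjectivity in dimension `l` concludes.
theorem strictLiftProp_option (e : ι ≃ Fin k) {l : ℕ} (e' : Option ι ≃ Fin l) (hφ : DSmooth φ)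
    (inj : ∀ x, Function.Injective (HomotopySet.map k φ hφ x))
    (surj : ∀ x, Function.Surjective (HomotopySet.map l φ hφ x)) :
    StrictLiftProp (Option ι) φ := by
  intro ε hε hε'
  -- Scales: `ε / 8` after extending over the top, a further `4` for the tame null homotopy, `128`
  -- for the extendable case and `4` for undoing the deformation.
  refine ⟨ε / 16384, by positivity, by linarith, fun α β D => ?_⟩
  have tα : ∀ η, 0 < η → η ≤ ε → Tame₂ η (fun t τ => α (ocons t τ)) := fun η hη hle t τ => by
    beta_reduce
    rw [← kapv_ocons]
    exact D.tame.mono hη hε' hle _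
  obtain ⟨G, G1, G2, G3, G4⟩ := exists_fill hε hε' (tα ε hε le_rfl)
    (D.smooth.comp contDiff_ocons fun p hp => mem_col_option.2 (Or.inl hp))
  set δ := ε / 8 with hδ
  have hδ0 : 0 < δ := by positivity
  have hδ' : δ ≤ 1 / 32 := by linarith
  have hε2 : 0 < ε / 2 := by positivity
  have hε2' : ε / 2 ≤ 1 / 4 := by linarith
  -- `C` contracts the filling `G` of the open box to its value at the origin.
  set C : (Option ι → ℝ) → ℝ → X := fun u s =>
    G (sg (1 / 4) s • sgv (ε / 2) (otail u)) (sg (1 / 4) s * sg (ε / 2) (u none)) with hC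
  set x : X := G 0 0 with hx
  have C0 : ∀ u, C u 0 = x := fun u => by
    simp only [hC, sg_zero quarter_pos le_rfl, zero_smul, zero_mul, hx]
  have C1 : ∀ u, C u 1 = G (otail u) (u none) := fun u => by
    simp only [hC, sg_one quarter_pos le_rfl, one_smul, one_mul]
    rw [G1.sg hε2 hε2']
    exact (G1.left hε2 hε2' _).sgv hε2 hε2' _
  have Ctame : ∀ η, 0 < η → η ≤ ε / 4 → Tame₂ η C := fun η hη hle u s => by
    simp only [hC, otail_kapv, kapv_none]
    rw [sg_kap hη (by linarith) le_rfl, sg_kap hη (by linarith) hε2',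
      sgv_kapv hη (by linarith) hε2']
  have Csm : PlotOn (fun p : (Option ι → ℝ) × ℝ => C p.1 p.2) univ :=
    G2.comp (((((contDiff_sg _).comp contDiff_snd).smul ((contDiff_sgv _).comp
      (contDiff_otail.comp contDiff_fst)))).prodMk (((contDiff_sg _).comp contDiff_snd).mul
        ((contDiff_sg _).comp ((contDiff_apply ℝ ℝ none).comp contDiff_fst)))) (mapsTo_univ _ _)
  have Ctop : ∀ u s, 1 - δ < u none → C (ocons (otail u) 1) s = C u s := fun u s hu => by
    simp only [hC, otail_ocons, ocons_none]
    rw [sg_of_ge (s := u none) hε2 hε2' (by linarith), sg_one hε2 hε2']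
  -- On the top, `α` need not agree with `G`, so the contraction of the rim is extended to a
  -- homotopy ending in `α` itself.
  obtain ⟨K, K1, K2, K3, K4⟩ := exists_homotopy_ext_one (ι := ι) (X := X) (ε := ε / 4)
    (by positivity) (by linarith) (g₁ := fun t => α (ocons t 1)) (g := fun t s => C (ocons t 1) s)
    ((tα (ε / 4) (by positivity) (by linarith)).left (by positivity) (by linarith) 1)
    (fun t s => by
      have := Ctame (ε / 4) (by positivity) le_rfl (ocons t 1) s
      rwa [kapv_ocons, kap_one (by positivity) (by linarith)] at this)
    (D.smooth.comp (contDiff_ocons.comp (contDiff_id.prodMk contDiff_const))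
      fun t _ => mem_col_option.2 (Or.inr (by simp [hε])))
    ((Csm.comp (g := fun p : (ι → ℝ) × ℝ => (ocons p.1 1, p.2))
      ((contDiff_ocons.comp (contDiff_fst.prodMk contDiff_const)).prodMk contDiff_snd)
      (mapsTo_univ _ univ)).mono (subset_univ _))
    (fun t ht => by
      rw [C1, otail_ocons, ocons_none, G3 _ (col_mono (by linarith) ht)])
  rw [show ε / 4 / 2 = δ by rw [hδ]; ring] at K1 K3
  set a : (Option ι → ℝ) → ℝ → X := fun u s => if 1 - δ < u none then K (otail u) s else C u s
    with ha
  have aK : ∀ u s, 1 - δ < u none → a u s = K (otail u) s := fun u s h => if_pos h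
  have aC : ∀ u s, otail u ∈ col ι δ ∨ u none < δ → a u s = C u s := fun u s h => by
    by_cases h1 : 1 - δ < u none
    · rcases h with h | h
      · rw [aK u s h1, K3 _ h, Ctop u s h1]
      · linarith
    · exact if_neg h1
  obtain ⟨β₀, D₀, hS⟩ := (D.mono hδ0 hε' (by linarith)).deform hδ0 (by linarith) hφ (a := a)
    (fun u s => by
      simp only [ha, otail_kapv, kapv_none, lt_kap_iff hδ0 (show δ ≤ 1 / 4 by linarith) le_rfl,
        K1 _ s, Ctame δ hδ0 (by linarith) u s])
    (by
      have c1 : Continuous fun p : (Option ι → ℝ) × ℝ => otail p.1 :=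
        contDiff_otail.continuous.comp continuous_fst
      have c2 : Continuous fun p : (Option ι → ℝ) × ℝ => p.1 none :=
        (continuous_apply none).comp continuous_fst
      refine PlotOn.mono (U := {p : (Option ι → ℝ) × ℝ | otail p.1 ∈ col ι δ ∨ p.1 none < δ} ∪
        {p | 1 - δ < p.1 none}) (PlotOn.union ?_ ?_ ?_ ?_) (fun p hp => mem_col_option.1 hp)
      · exact ((isOpen_col δ).preimage c1).union (isOpen_lt c2 continuous_const)
      · exact isOpen_lt continuous_const c2
      · exact (Csm.mono (subset_univ _)).congr fun p hp => aC _ _ hp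
      · exact (K2.comp (g := fun p : (Option ι → ℝ) × ℝ => (otail p.1, p.2))
          ((contDiff_otail.comp contDiff_fst).prodMk contDiff_snd)
          (mapsTo_univ _ _)).congr fun p hp => aK _ _ hp)
    (fun u hu => by
      rw [mem_col_option] at hu
      have tα' := tα δ hδ0 (by linarith)
      rcases hu with (hu | hu) | hu
      · rw [aC u 1 (Or.inl hu), C1, G3 _ (col_mono (by linarith) hu), ocons_otail]
      · rw [aC u 1 (Or.inr hu), C1, G1.of_lt hε2 hε2' _ (by linarith), G4]
        exact (tα'.of_lt hδ0 (by linarith) (otail u) hu).symm.trans (by rw [ocons_otail])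
      · rw [aK u 1 hu, K4]
        exact (tα'.of_gt hδ0 (by linarith) (otail u) hu).symm.trans (by rw [ocons_otail]))
  have hb : ∀ t ∈ col ι δ, K t 0 = x := fun t ht => by rw [K3 t ht, C0]
  have sb : PlotOn (fun t => K t 0) univ :=
    K2.comp (contDiff_id.prodMk contDiff_const) (mapsTo_univ _ _)
  have tb : Tame δ (fun t => K t 0) := K1.left hδ0 (by linarith) 0
  have ax : ∀ u, otail u ∈ col ι δ → a u 0 = x := fun u hu => by rw [aC u 0 (Or.inl hu), C0]
  have hhom : PairHomotopic (PairMap.ofTame e hδ0 (plotOn_const x univ) (x := x) fun _ _ => rfl)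
      (PairMap.ofTame e hδ0 sb hb) := by
    refine pairHomotopic_of_eq (inj x (Quot.sound ⟨fun q => β₀ (ocons (fromCube e q.1) q.2),
      (D₀.smooth'.comp contDiff_ocons (mapsTo_univ _ univ)).dSmooth_fromCube_prod e, fun z => ?_,
      fun z => ?_, fun z hz s => ?_⟩))
    · change β₀ (ocons (fromCube e z) 0) = φ x
      rw [D₀.comm _ (mem_col_option.2 (Or.inl (Or.inr (by rw [ocons_none]; positivity)))),
        aC _ _ (Or.inr (by rwa [ocons_none])), C0]
    · change β₀ (ocons (fromCube e z) 1) = φ (K (fromCube e z) 0)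
      rw [D₀.comm _ (mem_col_option.2 (Or.inr (by rw [ocons_none]; linarith))),
        aK _ _ (by rw [ocons_none]; linarith), otail_ocons]
    · have hz' := fromCube_boundary e hz
      change β₀ (ocons (fromCube e z) s) = φ x
      rw [D₀.comm _ (mem_col_option.2 (Or.inl (Or.inl (by
          rw [otail_ocons]; exact mem_col_of_boundary (half_pos hδ0) hz')))),
        ax _ (by rw [otail_ocons]; exact mem_col_of_boundary hδ0 hz')]
  obtain ⟨F, hF, h0, h1, hA⟩ := (pairHomotopic_equivalence _ _).symm hhom
  obtain ⟨L, L1, L2, L3, L4, L5⟩ := exists_tame_homotopy e (δ := δ / 2) (by positivity) le_rfl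
    (by linarith) (by linarith) tb sb hb hF h0 hA
  set η := δ / 2 / 2 with hη
  have hη0 : 0 < η := by positivity
  have L6 : ∀ t, L t 1 = x := fun t => by rw [L4, h1]; rfl
  -- `L` runs from the sphere to the constant `x`; reversed in the last coordinate, it has the
  -- sphere on the top and `x` on the open box.
  have S := StrictDatum.solvable_of_extends e' hη0 (by linarith) hφ surj
    (D₀.mono hη0 (by linarith) (by linarith)) (g := fun u => L (otail u) (1 - u none))
    (fun u => by
      simp only [otail_kapv, kapv_none]
      rw [← kap_one_sub (by linarith), L1])
    (L2.comp (g := fun u : Option ι → ℝ => (otail u, 1 - u none))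
      (contDiff_otail.prodMk (contDiff_const.sub (contDiff_apply ℝ ℝ none))) (mapsTo_univ _ _))
    (fun u hu => by
      rw [mem_col_option] at hu
      rcases hu with (hu | hu) | hu
      · rw [L5 _ hu, ax u (col_mono (by linarith) hu)]
      · rw [L1.of_gt hη0 (by linarith) _ (by linarith), L6, aC u 0 (Or.inr (by linarith)), C0]
      · rw [L1.of_lt hη0 (by linarith) _ (by linarith), L3, aK u 0 (by linarith)])
  have := hS (η / 128) (by positivity) (by linarith) S
  convert this using 1
  rw [hη, hδ]
  ring

theorem LiftProp.of_equiv {κ : Type*} [Fintype κ] (e : ι ≃ κ) (h : LiftProp κ φ) :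
    LiftProp ι φ := by
  intro ε hε hε'
  obtain ⟨δ, hδ, hδε, h⟩ := h ε hε hε'
  refine ⟨δ, hδ, hδε, fun α H D => ?_⟩
  have hc : ∀ {η : ℝ} {t : κ → ℝ}, t ∘ e ∈ col ι η ↔ t ∈ col κ η := fun {η t} => by
    simp only [col, mem_ofPred_eq, Function.comp_apply]
    exact e.exists_congr_left.trans (by simp)
  have hc' : ∀ {η : ℝ} {t : ι → ℝ}, t ∈ col ι η → t ∘ e.symm ∈ col κ η := fun {η t} ht => by
    rw [← hc, Function.comp_assoc, e.symm_comp_self]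
    exact ht
  have hs : ContDiff ℝ ∞ fun t : κ → ℝ => t ∘ e := contDiff_pi.2 fun i => contDiff_apply ℝ ℝ (e i)
  have hs' : ContDiff ℝ ∞ fun t : ι → ℝ => t ∘ e.symm :=
    contDiff_pi.2 fun i => contDiff_apply ℝ ℝ (e.symm i)
  have he : ∀ t : ι → ℝ, (t ∘ e.symm) ∘ e = t := fun t => by
    rw [Function.comp_assoc, e.symm_comp_self, Function.comp_id]
  obtain ⟨α', H', S⟩ := h (fun t => α (t ∘ e)) (fun t s => H (t ∘ e) s)
    ⟨fun t => D.tame (t ∘ e), fun t s => D.tame₂ (t ∘ e) s, D.smooth.comp hs fun t ht => hc.2 ht,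
      D.smooth₂.comp (g := fun p : (κ → ℝ) × ℝ => (p.1 ∘ e, p.2))
        ((hs.comp contDiff_fst).prodMk contDiff_snd) (fun p hp => hp.imp hc.2 id),
      fun t ht => D.top _ (hc.2 ht)⟩
  refine ⟨fun t => α' (t ∘ e.symm), fun t s => H' (t ∘ e.symm) s,
    fun t => S.tame (t ∘ e.symm), fun t s => S.tame₂ (t ∘ e.symm) s,
    S.smooth.comp hs' (mapsTo_univ _ _),
    S.smooth₂.comp (g := fun p : (ι → ℝ) × ℝ => (p.1 ∘ e.symm, p.2))
        ((hs'.comp contDiff_fst).prodMk contDiff_snd) (mapsTo_univ _ _),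
    fun t ht => ?_, fun t ht s => ?_, fun t => ?_, fun t => S.one _⟩
  · rw [S.eq _ (hc' ht), he]
  · rw [S.eq₂ _ (hc' ht), he]
  · rw [S.zero, he]

/-- Weak homotopy equivalences have the lifting property for cubes. -/
theorem IsWeakHomotopyEquivalence.liftProp (h : IsWeakHomotopyEquivalence φ) : LiftProp ι φ := by
  classical
  have hφ := (h 0).smooth
  rcases isEmpty_or_nonempty ι with hι | ⟨⟨i⟩⟩
  · exact (strictLiftProp_of_isEmpty hφ (h 0).surjective_pathComponents).liftProp hφ
  -- Singling out a coordinate writes the cube as `I^k × I`.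
  · refine LiftProp.of_equiv (Equiv.optionSubtypeNe i).symm (StrictLiftProp.liftProp hφ ?_)
    exact strictLiftProp_option (Fintype.equivFin _) (Fintype.equivFin _) hφ
      (fun x => (h _).injective x _ (Nat.lt_succ_self _)) (fun x => (h _).surjective x _ le_rfl)

end WeakEquivalence

/-! ### Lifting problems inside subspaces -/

section Subspaces

variable {ι X Y : Type*} [Fintype ι] [DiffeologicalSpace X] [DiffeologicalSpace Y] {φ : X → Y}
  {ε δ : ℝ}

variable (ι) in
/-- Lifting problems with values in the subspaces `A` and `B` have solutions with values in `A`
and `B`. -/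
def SolvableOn (φ : X → Y) (A : Set X) (B : Set Y) (ε δ : ℝ) : Prop :=
  ∀ (α : (ι → ℝ) → X) (h : (ι → ℝ) → ℝ → Y), LiftDatum φ ε α h → (∀ t ∈ col ι ε, α t ∈ A) →
    (∀ t s, t ∈ col ι ε ∨ s < ε → h t s ∈ B) →
    ∃ α' H, LiftSolution φ δ α h α' H ∧ (∀ t, α' t ∈ A) ∧ ∀ t s, H t s ∈ B

theorem SolvableOn.mono {A : Set X} {B : Set Y} {η : ℝ} (h : SolvableOn ι φ A B ε δ) (hη : 0 < η)
    (hδ : δ ≤ 1 / 4) (hle : η ≤ δ) : SolvableOn ι φ A B ε η := fun α H D hA hB =>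
  let ⟨α', H', S, h1, h2⟩ := h α H D hA hB
  ⟨α', H', S.mono hη hδ hle, h1, h2⟩

open Classical in
theorem exists_solvableOn {A : Set X} {B : Set Y} (hAB : MapsTo φ A B)
    (hw : IsWeakHomotopyEquivalence (hAB.restrict φ A B)) (hε : 0 < ε) (hε' : ε ≤ 1 / 4) :
    ∃ δ, 0 < δ ∧ δ ≤ ε ∧ SolvableOn ι φ A B ε δ := by
  obtain ⟨δ, hδ, hδε, hL⟩ := hw.liftProp (ι := ι) ε hε hε'
  refine ⟨δ, hδ, hδε, fun α h D hα hh => ?_⟩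
  -- Default values for corestricting total functions to `A` and `B`: the datum provides a point of
  -- `B`, and surjectivity on `π_0` then provides one of `A`. They are never taken where the datum
  -- is constrained.
  have b₀ : B := ⟨h 0 0, hh 0 0 (Or.inr hε)⟩
  obtain ⟨q, -⟩ := (hw 0).surjective_pathComponents (Quot.mk _ b₀)
  obtain ⟨a₀, -⟩ := Quot.exists_rep q
  let rA : X → A := fun x => if hx : x ∈ A then ⟨x, hx⟩ else a₀
  let rB : Y → B := fun y => if hy : y ∈ B then ⟨y, hy⟩ else b₀
  have hrA : ∀ x ∈ A, (rA x : X) = x := fun x hx => by simp only [rA, dif_pos hx]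
  have hrB : ∀ y ∈ B, (rB y : Y) = y := fun y hy => by simp only [rB, dif_pos hy]
  obtain ⟨α', H, S⟩ := hL (fun t => rA (α t)) (fun t s => rB (h t s))
    ⟨fun t => congrArg rA (D.tame t), fun t s => congrArg rB (D.tame₂ t s),
      fun n p hp hU => isPlot_subtype.2 <| by
        refine (congrArg IsPlot (funext fun r => ?_)).mp (D.smooth p hp hU)
        exact (hrA _ (hα _ (hU r))).symm,
      fun n p hp hU => isPlot_subtype.2 <| by
        refine (congrArg IsPlot (funext fun r => ?_)).mp (D.smooth₂ p hp hU)
        exact (hrB _ (hh _ _ (hU r))).symm,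
      fun t ht => Subtype.ext <| by
        rw [hrB _ (hh _ _ (Or.inl ht)), D.top t ht]
        exact (congrArg φ (hrA _ (hα t ht))).symm⟩
  refine ⟨fun t => α' t, fun t s => H t s, ⟨fun t => congrArg _ (S.tame t),
    fun t s => congrArg _ (S.tame₂ t s), S.smooth.dsmooth_comp (dSmooth_val A),
    S.smooth₂.dsmooth_comp (dSmooth_val B), fun t ht => ?_, fun t ht s => ?_, fun t => ?_,
    fun t => ?_⟩, fun t => (α' t).2, fun t s => (H t s).2⟩
  · rw [S.eq t ht, hrA _ (hα t (col_mono hδε ht))]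
  · rw [S.eq₂ t ht, hrB _ (hh _ _ (Or.inl (col_mono hδε ht)))]
  · rw [S.zero, hrB _ (hh _ _ (Or.inr hε))]
  · rw [S.one]; rfl

end Subspaces

/-! ### The cell structure of the integer lattice -/

section Lattice

/-- Round a real number to the nearest integer if it is at distance less than `ε` from it. -/
noncomputable def rnd (ε s : ℝ) : ℝ := ⌊s⌋ + kap ε (Int.fract s)

variable {ε δ s u : ℝ}

theorem rnd_int_add (hε : 0 < ε) (hε' : ε ≤ 1 / 4) (n : ℤ) (h0 : 0 ≤ u) (h1 : u ≤ 1) :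
    rnd ε (n + u) = n + kap ε u := by
  rcases h1.lt_or_eq with h1 | rfl
  · rw [rnd, Int.floor_intCast_add, Int.fract_intCast_add, Int.floor_eq_zero_iff.2 ⟨h0, h1⟩,
      Int.fract_eq_self.2 ⟨h0, h1⟩, add_zero]
  · rw [rnd, Int.floor_intCast_add, Int.fract_intCast_add, kap_one hε hε', Int.floor_one,
      Int.fract_one, kap_zero hε]
    push_cast; ring

theorem rnd_rnd (hδ : 0 < δ) (hε' : ε ≤ 1 / 4) (h : δ ≤ ε) (s : ℝ) :
    rnd ε (rnd δ s) = rnd ε s := by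
  have hm := kap_mem hδ (h.trans hε') (Int.fract s)
  rw [rnd.eq_def δ, rnd_int_add (hδ.trans_le h) hε' _ hm.1 hm.2, kap_kap hδ hε' h, rnd]

theorem rnd_face (hε : 0 < ε) (hε' : ε ≤ 1 / 4) (s : ℝ) :
    (⌊s⌋ : ℝ) ≤ rnd ε s ∧ rnd ε s ≤ ⌈s⌉ := by
  have hm := kap_mem hε hε' (Int.fract s)
  refine ⟨by rw [rnd]; linarith [hm.1], ?_⟩
  rcases eq_or_ne (Int.fract s) 0 with h | h
  · rw [rnd, h, kap_zero hε, add_zero]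
    exact_mod_cast Int.floor_le_ceil s
  · have := Int.ceil_eq_add_one_sub_fract h
    have h2 := Int.floor_add_fract s
    rw [rnd]
    linarith [hm.2]

/-- Rounding to an integer happens on an open set, so `rnd` is locally constant there. Elsewhere
`rnd ε s₀ = s₀` lies inside a unit interval, which also contains all nearby points, and on it `rnd`
is a translate of `kap`. -/
theorem rnd_near (hε : 0 < ε) (hε' : ε ≤ 1 / 4) (s₀ : ℝ) : ∀ᶠ s in 𝓝 s₀,
    ((⌊rnd ε s₀⌋ : ℝ) ≤ rnd ε s ∧ rnd ε s ≤ ⌈rnd ε s₀⌉) ∧ (⌊rnd ε s₀⌋ ≠ ⌈rnd ε s₀⌉ →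
      kap ε (s - ⌊rnd ε s₀⌋) = rnd ε s - ⌊rnd ε s₀⌋) := by
  have key : ∀ m : ℤ, |s₀ - m| < ε → ∀ᶠ s in 𝓝 s₀, rnd ε s = m := fun m hm => by
    have hc : Continuous fun s : ℝ => |s - m| := by fun_prop
    have : ∀ᶠ s : ℝ in 𝓝 s₀, |s - m| < ε := (hc.tendsto s₀).eventually (gt_mem_nhds hm)
    filter_upwards [this] with s hs
    rw [abs_lt] at hs
    rcases le_or_gt 0 (s - m) with h | h
    · have := rnd_int_add hε hε' m h (by linarith)
      rw [add_sub_cancel] at this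
      rw [this, kap_of_lt (by linarith), add_zero]
    · have := rnd_int_add (u := s - m + 1) hε hε' (m - 1) (by linarith) (by linarith)
      rw [kap_of_gt hε' (by linarith)] at this
      push_cast at this
      rw [show (m : ℝ) - 1 + (s - m + 1) = s by ring] at this
      rw [this]; ring
  have h2 := Int.floor_add_fract s₀
  have hi : ∀ m : ℤ, |s₀ - m| < ε → ∀ᶠ s in 𝓝 s₀,
    ((⌊rnd ε s₀⌋ : ℝ) ≤ rnd ε s ∧ rnd ε s ≤ ⌈rnd ε s₀⌉) ∧ (⌊rnd ε s₀⌋ ≠ ⌈rnd ε s₀⌉ →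
      kap ε (s - ⌊rnd ε s₀⌋) = rnd ε s - ⌊rnd ε s₀⌋) := fun m hm => by
    have h0 := (key m hm).self_of_nhds
    filter_upwards [key m hm] with s hs
    rw [h0, hs]
    simp
  rcases kap_cases ε (Int.fract s₀) hε' with ⟨h, -⟩ | ⟨h, -⟩ | ⟨h, h', h''⟩
  · exact hi ⌊s₀⌋ (by rw [abs_lt]; constructor <;> linarith [Int.fract_nonneg s₀])
  · exact hi (⌊s₀⌋ + 1)
      (by rw [abs_lt]; push_cast; constructor <;> linarith [Int.fract_lt_one s₀])
  · have h0 : rnd ε s₀ = s₀ := by rw [rnd, h'', h2]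
    have hc := Int.ceil_eq_add_one_sub_fract (a := s₀) (by linarith)
    filter_upwards [lt_mem_nhds (show (⌊s₀⌋ : ℝ) < s₀ by linarith),
      gt_mem_nhds (show s₀ < (⌊s₀⌋ : ℝ) + 1 by linarith)] with s hs hs'
    have hr := rnd_int_add (u := s - ⌊s₀⌋) hε hε' ⌊s₀⌋ (by linarith) (by linarith)
    rw [add_sub_cancel] at hr
    have hm := kap_mem hε hε' (s - ⌊s₀⌋)
    rw [h0, hr]
    exact ⟨⟨by linarith [hm.1], by linarith [hm.2]⟩, fun _ => by ring⟩

variable {ι : Type*}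

/-- Coordinatewise rounding to the integer lattice. -/
noncomputable def rndv (ε : ℝ) (t : ι → ℝ) : ι → ℝ := fun i => rnd ε (t i)

/-- The open lattice cell containing a point, given by its lower and upper corners. -/
noncomputable def cell (t : ι → ℝ) : (ι → ℤ) × (ι → ℤ) := (fun i => ⌊t i⌋, fun i => ⌈t i⌉)

/-- The point `r` lies in the closure of the open lattice cell containing `t`. -/
def Face (r t : ι → ℝ) : Prop := ∀ i, (⌊t i⌋ : ℝ) ≤ r i ∧ r i ≤ ⌈t i⌉

theorem face_of_cell_eq {r t : ι → ℝ} (h : cell r = cell t) : Face r t := fun i => by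
  have h1 : ⌊r i⌋ = ⌊t i⌋ := congrFun (congrArg Prod.fst h) i
  have h2 : ⌈r i⌉ = ⌈t i⌉ := congrFun (congrArg Prod.snd h) i
  rw [← h1, ← h2]
  exact ⟨Int.floor_le _, Int.le_ceil _⟩

theorem rndv_rndv (hδ : 0 < δ) (hε' : ε ≤ 1 / 4) (h : δ ≤ ε) (t : ι → ℝ) :
    rndv ε (rndv δ t) = rndv ε t := funext fun i => rnd_rnd hδ hε' h (t i)

theorem face_rndv (hε : 0 < ε) (hε' : ε ≤ 1 / 4) (t : ι → ℝ) : Face (rndv ε t) t :=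
  fun i => rnd_face hε hε' (t i)

variable [Fintype ι]

/-- The coordinate directions of a cell. -/
def dirs (z : (ι → ℤ) × (ι → ℤ)) : Finset ι := Finset.univ.filter fun i => z.1 i ≠ z.2 i

/-- The coordinates on a cell. -/
def coords (z : (ι → ℤ) × (ι → ℤ)) (t : ι → ℝ) : dirs z → ℝ := fun j => t j - z.1 j

open Classical in
/-- The parametrization of a cell. -/
noncomputable def chart (z : (ι → ℤ) × (ι → ℤ)) (u : dirs z → ℝ) : ι → ℝ :=
  fun i => z.1 i + if h : i ∈ dirs z then u ⟨i, h⟩ else 0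

theorem contDiff_coords (z : (ι → ℤ) × (ι → ℤ)) : ContDiff ℝ ∞ (coords z) :=
  contDiff_pi.2 fun j => (contDiff_apply ℝ ℝ (j : ι)).sub contDiff_const

theorem contDiff_chart (z : (ι → ℤ) × (ι → ℤ)) : ContDiff ℝ ∞ (chart z) :=
  contDiff_pi.2 fun i => by
    unfold chart
    split_ifs with h
    · exact contDiff_const.add (contDiff_apply ℝ ℝ (⟨i, h⟩ : dirs z))
    · exact contDiff_const

theorem ceil_eq_of_ne {x : ℝ} (h : ⌊x⌋ ≠ ⌈x⌉) : ⌈x⌉ = ⌊x⌋ + 1 :=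
  le_antisymm (Int.ceil_le_floor_add_one x)
    (Int.add_one_le_iff.2 (lt_of_le_of_ne (Int.floor_le_ceil x) h))

theorem mem_dirs_cell {t : ι → ℝ} {i : ι} : i ∈ dirs (cell t) ↔ ⌊t i⌋ ≠ ⌈t i⌉ :=
  Finset.mem_filter.trans (and_iff_right (Finset.mem_univ i))

theorem Face.eq_of_notMem {r t : ι → ℝ} (h : Face r t) {i : ι} (hi : i ∉ dirs (cell t)) :
    r i = ⌊t i⌋ := by
  rw [mem_dirs_cell, not_not] at hi
  have := h i
  rw [← hi] at this
  exact le_antisymm this.2 this.1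

theorem Face.mem_Icc {r t : ι → ℝ} (h : Face r t) {i : ι} (hi : i ∈ dirs (cell t)) :
    r i ∈ Icc (⌊t i⌋ : ℝ) (⌊t i⌋ + 1) := by
  rw [mem_dirs_cell] at hi
  have := h i
  rw [ceil_eq_of_ne hi] at this
  exact_mod_cast this

theorem chart_coords {r t : ι → ℝ} (h : Face r t) : chart (cell t) (coords (cell t) r) = r := by
  funext i
  unfold chart
  split_ifs with hi
  · simp [coords]
  · rw [h.eq_of_notMem hi]; simp [cell]

theorem coords_mem_Icc {r t : ι → ℝ} (h : Face r t) (j : dirs (cell t)) :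
    coords (cell t) r j ∈ Icc (0 : ℝ) 1 := by
  have := h.mem_Icc j.2
  simp only [coords, cell]
  exact ⟨by linarith [this.1], by linarith [this.2]⟩

theorem rndv_chart (hε : 0 < ε) (hε' : ε ≤ 1 / 4) (z : (ι → ℤ) × (ι → ℤ)) {u : dirs z → ℝ}
    (hu : ∀ j, u j ∈ Icc (0 : ℝ) 1) : rndv ε (chart z u) = chart z (kapv ε u) := by
  funext i
  simp only [rndv, chart]
  split_ifs with hi
  · exact rnd_int_add hε hε' _ (hu _).1 (hu _).2
  · rw [rnd_int_add hε hε' _ le_rfl zero_le_one, kap_zero hε]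

theorem face_chart (t : ι → ℝ) {u : dirs (cell t) → ℝ} (hu : ∀ j, u j ∈ Icc (0 : ℝ) 1) :
    Face (chart (cell t) u) t := by
  intro i
  simp only [chart]
  split_ifs with hi
  · have h1 := (hu ⟨i, hi⟩).1
    have h2 := (hu ⟨i, hi⟩).2
    rw [ceil_eq_of_ne (mem_dirs_cell.1 hi)]
    push_cast
    change (⌊t i⌋ : ℝ) ≤ ⌊t i⌋ + u ⟨i, hi⟩ ∧ (⌊t i⌋ : ℝ) + u ⟨i, hi⟩ ≤ ⌊t i⌋ + 1
    constructor <;> linarith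
  · rw [mem_dirs_cell, not_not] at hi
    rw [← hi]
    simp [cell]

theorem Face.dirs_subset {r t : ι → ℝ} (h : Face r t) : dirs (cell r) ⊆ dirs (cell t) := by
  intro i hi
  by_contra hi'
  rw [mem_dirs_cell, h.eq_of_notMem hi'] at hi
  simp at hi

/-- A proper face has a coordinate on the boundary. -/
theorem Face.cell_eq_or {r t : ι → ℝ} (h : Face r t) :
    cell r = cell t ∨ ∃ j, coords (cell t) r j = 0 ∨ coords (cell t) r j = 1 := by
  by_contra! hne
  refine hne.1 ?_
  have key : ∀ i, ⌊r i⌋ = ⌊t i⌋ ∧ ⌈r i⌉ = ⌈t i⌉ := fun i => by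
    by_cases hi : i ∈ dirs (cell t)
    · have h1 := h.mem_Icc hi
      have h2 := hne.2 ⟨i, hi⟩
      simp only [coords, cell] at h2
      have hl : (⌊t i⌋ : ℝ) < r i := lt_of_le_of_ne h1.1 fun e => h2.1 (by rw [← e]; ring)
      have hr : r i < ⌊t i⌋ + 1 := lt_of_le_of_ne h1.2 fun e => h2.2 (by rw [e]; ring)
      refine ⟨Int.floor_eq_iff.2 ⟨hl.le, hr⟩, ?_⟩
      rw [ceil_eq_of_ne (mem_dirs_cell.1 hi), Int.ceil_eq_iff]
      push_cast
      exact ⟨by linarith, hr.le⟩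
    · have h1 := h.eq_of_notMem hi
      rw [mem_dirs_cell, not_not] at hi
      rw [h1, ← hi]
      simp
  exact Prod.ext (funext fun i => (key i).1) (funext fun i => (key i).2)

/-- A point of a proper face has an integer coordinate in some direction of the cell, so its own
cell has fewer directions. -/
theorem Face.cell_eq_of_card {r t : ι → ℝ} (h : Face r t)
    (hc : (dirs (cell t)).card ≤ (dirs (cell r)).card) : cell r = cell t := by
  refine h.cell_eq_or.resolve_right ?_
  rintro ⟨j, hj⟩
  have : (j : ι) ∈ dirs (cell r) := by
    rw [Finset.eq_of_subset_of_card_le h.dirs_subset hc]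
    exact j.2
  rw [mem_dirs_cell] at this
  refine this ?_
  simp only [coords, cell, sub_eq_iff_eq_add] at hj
  rcases hj with hj | hj
  · rw [hj]; simp
  · rw [hj, show (1 : ℝ) + ⌊t j⌋ = ((1 + ⌊t j⌋ : ℤ) : ℝ) by push_cast; rfl]
    simp only [Int.floor_intCast, Int.ceil_intCast]

theorem card_dirs_chart_lt (t : ι → ℝ) {u : dirs (cell t) → ℝ} (hu : ∀ j, u j ∈ Icc (0 : ℝ) 1)
    (h : ∃ j, u j = 0 ∨ u j = 1) :
    (dirs (cell (chart (cell t) u))).card < (dirs (cell t)).card := by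
  by_contra hlt
  have hc := (face_chart t hu).cell_eq_of_card (not_lt.1 hlt)
  obtain ⟨j, hj⟩ := h
  have hj' : (j : ι) ∈ dirs (cell (chart (cell t) u)) := by rw [hc]; exact j.2
  rw [mem_dirs_cell] at hj'
  refine hj' ?_
  have e : chart (cell t) u j = ⌊t j⌋ + u j := by
    rw [chart, dif_pos j.2]; rfl
  rw [e]
  rcases hj with hj | hj <;> rw [hj] <;> simp

end Lattice

/-! ### Lifting cell by cell over skeleta -/

section Skeleta

variable {ι X Y Z : Type*} [Fintype ι] [DiffeologicalSpace X] [DiffeologicalSpace Y]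
  [DiffeologicalSpace Z] {φ : X → Y} {ε δ : ℝ}

theorem rndv_near (hε : 0 < ε) (hε' : ε ≤ 1 / 4) (t₀ : ι → ℝ) : ∃ W, IsOpen W ∧ t₀ ∈ W ∧
    ∀ t ∈ W, Face (rndv ε t) (rndv ε t₀) ∧
      kapv ε (coords (cell (rndv ε t₀)) t) = coords (cell (rndv ε t₀)) (rndv ε t) := by
  have h : ∀ᶠ t : ι → ℝ in 𝓝 t₀, ∀ i, ((⌊rnd ε (t₀ i)⌋ : ℝ) ≤ rnd ε (t i) ∧
      rnd ε (t i) ≤ ⌈rnd ε (t₀ i)⌉) ∧ (⌊rnd ε (t₀ i)⌋ ≠ ⌈rnd ε (t₀ i)⌉ →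
      kap ε (t i - ⌊rnd ε (t₀ i)⌋) = rnd ε (t i) - ⌊rnd ε (t₀ i)⌋) :=
    Filter.eventually_all.2 fun i =>
      ((continuous_apply i).tendsto t₀).eventually (rnd_near hε hε' (t₀ i))
  obtain ⟨W, hW, hWo, ht⟩ := mem_nhds_iff.1 h
  exact ⟨W, hWo, ht, fun t ht => ⟨fun i => (hW ht i).1,
    funext fun j => (hW ht j).2 (mem_dirs_cell (t := rndv ε t₀).1 j.2)⟩⟩

theorem kapv_mem_Icc {κ : Type*} (hε : 0 < ε) (hε' : ε ≤ 1 / 4) (u : κ → ℝ) (j : κ) :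
    kapv ε u j ∈ Icc (0 : ℝ) 1 := kap_mem hε hε' _

theorem sgv_mem_Icc {κ : Type*} (hε : 0 < ε) (hε' : ε ≤ 1 / 4) (u : κ → ℝ) (j : κ) :
    sgv ε u j ∈ Icc (0 : ℝ) 1 := sg_mem hε hε' _

open Classical in
/-- Gluing a map on a subcomplex of the lattice with maps on further cells. -/
theorem PlotOn.glue (hδ : 0 < δ) (hδε : δ ≤ ε) (hε' : ε ≤ 1 / 4) {S S' : Set (ι → ℝ)}
    (hS : ∀ r t, Face r t → t ∈ S → r ∈ S)
    (hSS' : ∀ r t, Face r t → t ∈ S' → r ∉ S → cell r = cell t)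
    {f : (ι → ℝ) → ℝ → Z} {F : ∀ z : (ι → ℤ) × (ι → ℤ), (dirs z → ℝ) → ℝ → Z}
    (hf : ∀ t s, f (rndv ε t) (kap ε s) = f t s)
    (sf : PlotOn (fun p : (ι → ℝ) × ℝ => f p.1 p.2) {p | rndv ε p.1 ∈ S})
    (hF : ∀ t ∈ S', t ∉ S → Tame₂ δ (F (cell t)))
    (sF : ∀ t ∈ S', t ∉ S → PlotOn (fun p : (dirs (cell t) → ℝ) × ℝ => F (cell t) p.1 p.2) univ)
    (h : ∀ t ∈ S', t ∉ S → ∀ u ∈ col (dirs (cell t)) δ, ∀ s,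
      F (cell t) u s = f (chart (cell t) (kapv ε u)) (kap ε s)) :
    PlotOn (fun p : (ι → ℝ) × ℝ => if rndv δ p.1 ∈ S then f (rndv δ p.1) (kap δ p.2) else
      F (cell (rndv δ p.1)) (coords (cell (rndv δ p.1)) (rndv δ p.1)) (kap δ p.2))
      {p | rndv δ p.1 ∈ S'} := by
  have hδ' : δ ≤ 1 / 4 := hδε.trans hε'
  have hε : 0 < ε := hδ.trans_le hδε
  have hf' : ∀ t s, f (rndv δ t) (kap δ s) = f t s := fun t s => by
    rw [← hf, rndv_rndv hδ hε' hδε, kap_kap hδ hε' hδε, hf]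
  refine plotOn_of_locally fun ⟨t₀, s₀⟩ h₀ => ?_
  obtain ⟨W, hW, ht₀, hWt⟩ := rndv_near hδ hδ' t₀
  refine ⟨Prod.fst ⁻¹' W, hW.preimage continuous_fst, ht₀, ?_⟩
  -- Nearby points round into the closed cell of `rndv δ t₀`. If that cell is in `S`, only `f`
  -- occurs; otherwise `F z` describes the map on a whole neighbourhood, as it agrees with `f` on
  -- the boundary of the cell.
  by_cases hr₀ : rndv δ t₀ ∈ S
  · have hin : ∀ t ∈ W, rndv δ t ∈ S := fun t ht => hS _ _ (hWt t ht).1 hr₀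
    refine PlotOn.congr (f := fun p => f p.1 p.2) (sf.mono fun p hp => ?_) fun p hp => ?_
    · have := hS _ _ (face_rndv hε hε' (rndv δ p.1)) (hin _ hp.2)
      rwa [rndv_rndv hδ hε' hδε] at this
    · rw [if_pos (hin _ hp.2), hf']
  · have h₁ : rndv δ t₀ ∈ S' := h₀
    set z := cell (rndv δ t₀) with hz
    refine ((sF _ h₁ hr₀).comp (g := fun p : (ι → ℝ) × ℝ => (coords z p.1, p.2))
      (((contDiff_coords z).comp contDiff_fst).prodMk contDiff_snd)
      (mapsTo_univ _ univ)).mono (subset_univ _) |>.congr fun p hp => ?_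
    obtain ⟨hface, hkap⟩ := hWt p.1 hp.2
    have hFp : F z (coords z p.1) p.2 = F z (coords z (rndv δ p.1)) (kap δ p.2) := by
      rw [← hF _ h₁ hr₀, hkap]
    rw [hFp]
    by_cases hr : rndv δ p.1 ∈ S
    · rw [if_pos hr]
      rcases hface.cell_eq_or with hc | hc
      · exact absurd (hS _ _ (face_of_cell_eq hc.symm) hr) hr₀
      · rw [h _ h₁ hr₀ _ (mem_col_of_boundary hδ hc), ← rndv_chart hε hε' _ (coords_mem_Icc hface),
          chart_coords hface, hf]
    · rw [if_neg hr, hSS' _ _ hface h₁ hr]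

/-- The union of a subcomplex of the lattice and of the cells of dimension less than `n`. -/
def skel (K : Set (ι → ℝ)) (n : ℕ) : Set (ι → ℝ) := {t | t ∈ K ∨ (dirs (cell t)).card < n}

theorem skel_face {K : Set (ι → ℝ)} (hK : ∀ r t, Face r t → t ∈ K → r ∈ K) {n : ℕ}
    (r t : ι → ℝ) (h : Face r t) (ht : t ∈ skel K n) : r ∈ skel K n :=
  ht.imp (hK r t h) fun h' => (Finset.card_le_card h.dirs_subset).trans_lt h'

/-- A partial lift over the skeleton `skel K n`. -/
structure PartialLift (φ : X → Y) (A : (ι → ℝ) → Set X) (B : (ι → ℝ) → Set Y) (K : Set (ι → ℝ))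
    (α₀ : (ι → ℝ) → X) (β : (ι → ℝ) → Y) (n : ℕ) (ε : ℝ) (α : (ι → ℝ) → X)
    (H : (ι → ℝ) → ℝ → Y) : Prop where
  tame : ∀ t, α (rndv ε t) = α t
  tame₂ : ∀ t s, H (rndv ε t) (kap ε s) = H t s
  smooth : PlotOn α {t | rndv ε t ∈ skel K n}
  smooth₂ : PlotOn (fun p : (ι → ℝ) × ℝ => H p.1 p.2) {p | rndv ε p.1 ∈ skel K n}
  mem : ∀ t ∈ skel K n, α t ∈ A t
  mem₂ : ∀ t ∈ skel K n, ∀ s, H t s ∈ B t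
  zero : ∀ t, H t 0 = β t
  one : ∀ t ∈ skel K n, H t 1 = φ (α t)
  eq : ∀ t ∈ K, α t = α₀ t
  eq₂ : ∀ t ∈ K, ∀ s, H t s = β t

variable {A : (ι → ℝ) → Set X} {B : (ι → ℝ) → Set Y} {K : Set (ι → ℝ)} {α₀ : (ι → ℝ) → X}
  {β : (ι → ℝ) → Y} {n : ℕ} {α : (ι → ℝ) → X} {H : (ι → ℝ) → ℝ → Y}

/-- The lifting problem posed by a partial lift on a cell of the next dimension. -/
theorem PartialLift.exists_cell_lift (hε : 0 < ε) (hε' : ε ≤ 1 / 4)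
    (hA : ∀ r t, Face r t → A r ⊆ A t) (hB : ∀ r t, Face r t → B r ⊆ B t)
    (sβ : PlotOn β univ) (hβ : ∀ t, β t ∈ B t) (P : PartialLift φ A B K α₀ β n ε α H)
    {t : ι → ℝ} (ht : t ∈ skel K (n + 1)) (ht' : t ∉ skel K n)
    (hs : SolvableOn (dirs (cell t)) φ (A t) (B t) ε δ) :
    ∃ α' H', LiftSolution φ δ (fun u => α (chart (cell t) (kapv ε u)))
        (fun u s => H (chart (cell t) (kapv ε u)) (kap ε s)) α' H' ∧
      (∀ u, α' u ∈ A t) ∧ ∀ u s, H' u s ∈ B t := by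
  have hcard : (dirs (cell t)).card < n + 1 :=
    ht.resolve_left fun h => ht' (Or.inl h)
  have hk := fun u => kapv_mem_Icc (κ := dirs (cell t)) hε hε' u
  have hface : ∀ u, Face (chart (cell t) (kapv ε u)) t := fun u => face_chart t (hk u)
  have hcol : ∀ u ∈ col (dirs (cell t)) ε, chart (cell t) (kapv ε u) ∈ skel K n := by
    rintro u ⟨j, hj⟩
    refine Or.inr (lt_of_lt_of_le (card_dirs_chart_lt t (hk u) ⟨j, hj.imp kap_of_lt
      (kap_of_gt hε')⟩) (Nat.lt_succ_iff.1 hcard))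
  have hsg : ∀ u, rndv ε (chart (cell t) (sgv ε u)) = chart (cell t) (kapv ε u) := fun u => by
    rw [rndv_chart hε hε' _ (sgv_mem_Icc hε hε' u), kapv_sgv hε hε']
  have hkk : ∀ u : dirs (cell t) → ℝ, kapv ε (kapv ε u) = kapv ε u := kapv_kapv hε hε' le_rfl
  have hks : ∀ s, kap ε (kap ε s) = kap ε s := kap_kap hε hε' le_rfl
  have cs : ContDiff ℝ ∞ fun u : dirs (cell t) → ℝ => chart (cell t) (sgv ε u) :=
    (contDiff_chart _).comp (contDiff_sgv _)
  have hβr : ∀ t, β (rndv ε t) = β t := fun t => by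
    rw [← P.zero, ← P.zero, ← P.tame₂ t, kap_zero hε]
  refine hs _ _ ⟨fun u => ?_, fun u s => ?_, ?_, ?_, fun u hu => ?_⟩ (fun u hu => ?_)
    fun u s hus => ?_
  · rw [hkk]
  · rw [hkk, hks]
  · refine (P.smooth.comp cs fun u hu => ?_).congr fun u hu => ?_
    · rw [mem_ofPred_eq, hsg]
      exact hcol u hu
    · rw [← hsg, P.tame]
  · refine PlotOn.union (U := {p : (dirs (cell t) → ℝ) × ℝ | p.1 ∈ col (dirs (cell t)) ε})
      (V := {p | p.2 < ε}) ((isOpen_col ε).preimage continuous_fst)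
      (isOpen_lt continuous_snd continuous_const) ?_ ?_
    · refine (P.smooth₂.comp (g := fun p : (dirs (cell t) → ℝ) × ℝ =>
        (chart (cell t) (sgv ε p.1), p.2)) ((cs.comp contDiff_fst).prodMk contDiff_snd)
        fun p hp => ?_).congr fun p hp => ?_
      · rw [mem_ofPred_eq, hsg]
        exact hcol _ hp
      · rw [← hsg, P.tame₂]
    · refine (sβ.comp (g := fun p : (dirs (cell t) → ℝ) × ℝ => chart (cell t) (sgv ε p.1))
        (cs.comp contDiff_fst) (mapsTo_univ _ _)).congr fun p hp => ?_
      rw [kap_of_lt hp, P.zero, ← hsg, hβr]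
  · rw [kap_one hε hε', P.one _ (hcol u hu)]
  · exact hA _ _ (hface u) (P.mem _ (hcol u hu))
  · rcases hus with hu | hs
    · exact hB _ _ (hface u) (P.mem₂ _ (hcol u hu) _)
    · rw [kap_of_lt hs, P.zero]
      exact hB _ _ (hface u) (hβ _)

open Classical in
-- The boundary of a new cell lies in the lower skeleton, so each new cell poses a lifting problem
-- independent of the others; the uniform `δ` lets all solutions be glued at once.
theorem PartialLift.exists_succ [Nonempty X] [Nonempty Y] (hε : 0 < ε) (hε' : ε ≤ 1 / 4)
    (hA : ∀ r t, Face r t → A r ⊆ A t) (hB : ∀ r t, Face r t → B r ⊆ B t)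
    (hK : ∀ r t, Face r t → t ∈ K → r ∈ K)
    (sβ : PlotOn β univ) (hβ : ∀ t, β t ∈ B t) (P : PartialLift φ A B K α₀ β n ε α H)
    (hδ : 0 < δ) (hδε : δ ≤ ε) (hs : ∀ t, SolvableOn (dirs (cell t)) φ (A t) (B t) ε δ) :
    ∃ α' H', PartialLift φ A B K α₀ β (n + 1) δ α' H' := by
  have hδ' : δ ≤ 1 / 4 := hδε.trans hε'
  -- Solutions are chosen per cell and not per point, so that all points of a cell use the same one;
  -- on other cells arbitrary values serve.
  have cellLift : ∀ z : (ι → ℤ) × (ι → ℤ), ∃ (a : (dirs z → ℝ) → X) (h : (dirs z → ℝ) → ℝ → Y),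
      (∃ t, cell t = z ∧ t ∈ skel K (n + 1) ∧ t ∉ skel K n) →
      LiftSolution φ δ (fun u => α (chart z (kapv ε u)))
        (fun u s => H (chart z (kapv ε u)) (kap ε s)) a h ∧
      ∀ t, cell t = z → (∀ u, a u ∈ A t) ∧ ∀ u s, h u s ∈ B t := by
    intro z
    by_cases hz : ∃ t, cell t = z ∧ t ∈ skel K (n + 1) ∧ t ∉ skel K n
    · obtain ⟨t, rfl, ht, ht'⟩ := hz
      obtain ⟨a, h, S, ha, hh⟩ := P.exists_cell_lift hε hε' hA hB sβ hβ ht ht' (hs t)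
      exact ⟨a, h, fun _ => ⟨S, fun r hr => ⟨fun u => hA t r (face_of_cell_eq hr.symm) (ha u),
        fun u s => hB t r (face_of_cell_eq hr.symm) (hh u s)⟩⟩⟩
    · exact ⟨fun _ => Classical.arbitrary X, fun _ _ => Classical.arbitrary Y, fun h => absurd h hz⟩
  choose a h hah using cellLift
  have hz : ∀ t ∈ skel K (n + 1), t ∉ skel K n →
      LiftSolution φ δ (fun u => α (chart (cell t) (kapv ε u)))
        (fun u s => H (chart (cell t) (kapv ε u)) (kap ε s)) (a (cell t)) (h (cell t)) ∧
      (∀ u, a (cell t) u ∈ A t) ∧ ∀ u s, h (cell t) u s ∈ B t := fun t ht ht' =>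
    ⟨(hah (cell t) ⟨t, rfl, ht, ht'⟩).1, (hah (cell t) ⟨t, rfl, ht, ht'⟩).2 t rfl⟩
  have hSS' : ∀ r t, Face r t → t ∈ skel K (n + 1) → r ∉ skel K n → cell r = cell t := by
    intro r t hrt ht hr
    have ht2 : t ∉ K := fun h => hr (Or.inl (hK r t hrt h))
    have hcard := ht.resolve_left ht2
    refine hrt.cell_eq_of_card (le_trans (Nat.lt_succ_iff.1 hcard) ?_)
    exact not_lt.1 fun h => hr (Or.inr h)
  have hS := skel_face (n := n) hK
  have hS' := skel_face (n := n + 1) hK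
  have htr : ∀ t, α (rndv δ t) = α t := fun t => by
    rw [← P.tame, rndv_rndv hδ hε' hδε, P.tame]
  have hβr : ∀ t, β (rndv δ t) = β t := fun t => by
    rw [← P.zero, ← P.zero, ← P.tame₂, rndv_rndv hδ hε' hδε, P.tame₂]
  have hr : ∀ t : ι → ℝ, Face (rndv δ t) t := face_rndv hδ hδ'
  have hrr : ∀ t : ι → ℝ, rndv δ (rndv δ t) = rndv δ t := rndv_rndv hδ hδ' le_rfl
  have hkk : ∀ s, kap δ (kap δ s) = kap δ s := kap_kap hδ hδ' le_rfl
  have hfr : ∀ r : ι → ℝ, Face r r := fun r => face_of_cell_eq rfl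
  set α' : (ι → ℝ) → X := fun t => if rndv δ t ∈ skel K n then α (rndv δ t) else
    a (cell (rndv δ t)) (coords (cell (rndv δ t)) (rndv δ t)) with hα'
  -- Off the skeleton the value is `β`, since `H t 0 = β t` is required everywhere.
  set H' : (ι → ℝ) → ℝ → Y := fun t s => if rndv δ t ∈ skel K (n + 1) then
      (if rndv δ t ∈ skel K n then H (rndv δ t) (kap δ s) else
        h (cell (rndv δ t)) (coords (cell (rndv δ t)) (rndv δ t)) (kap δ s))
    else β (rndv δ t) with hH'
  refine ⟨α', H', fun t => ?_, fun t s => ?_, ?_, ?_, fun t ht => ?_, fun t ht s => ?_,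
    fun t => ?_, fun t ht => ?_, fun t ht => ?_, fun t ht s => ?_⟩
  · exact congrArg (fun r => if r ∈ skel K n then α r else a (cell r) (coords (cell r) r)) (hrr t)
  · simp only [hH', hkk]
    exact congrArg (fun r => if r ∈ skel K (n + 1) then (if r ∈ skel K n then H r (kap δ s) else
      h (cell r) (coords (cell r) r) (kap δ s)) else β r) (hrr t)
  · have := PlotOn.glue hδ hδε hε' hS hSS' (f := fun t _ => α t) (F := fun z u _ => a z u)
      (fun t s => P.tame t) (P.smooth.comp (g := Prod.fst) contDiff_fst fun p hp => hp)
      (fun t ht ht' u _ => (hz t ht ht').1.tame u)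
      (fun t ht ht' => (hz t ht ht').1.smooth.comp (g := Prod.fst) contDiff_fst (mapsTo_univ _ _))
      (fun t ht ht' u hu _ => (hz t ht ht').1.eq u hu)
    exact this.comp (g := fun t => (t, (0 : ℝ))) (contDiff_id.prodMk contDiff_const)
      fun t ht => ht
  · refine (PlotOn.glue hδ hδε hε' hS hSS' (f := H) (F := h) P.tame₂ P.smooth₂
      (fun t ht ht' => (hz t ht ht').1.tame₂) (fun t ht ht' => (hz t ht ht').1.smooth₂)
      (fun t ht ht' u hu s => (hz t ht ht').1.eq₂ u hu s)).congr fun p hp => if_pos hp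
  · by_cases h1 : rndv δ t ∈ skel K n
    · simp only [hα', if_pos h1]
      exact hA _ _ (hr t) (P.mem _ h1)
    · simp only [hα', if_neg h1]
      exact hA _ _ (hr t) ((hz _ (hS' _ _ (hr t) ht) h1).2.1 _)
  · by_cases h1 : rndv δ t ∈ skel K n
    · simp only [hH', if_pos h1, if_pos (hS' _ _ (hr t) ht)]
      exact hB _ _ (hr t) (P.mem₂ _ h1 _)
    · simp only [hH', if_neg h1, if_pos (hS' _ _ (hr t) ht)]
      exact hB _ _ (hr t) ((hz _ (hS' _ _ (hr t) ht) h1).2.2 _ _)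
  · simp only [hH', kap_zero hδ]
    split_ifs with h1 h2
    · rw [P.zero, hβr]
    · rw [(hz _ h1 h2).1.zero, kap_zero hε, ← rndv_chart hε hε' _ (coords_mem_Icc (hfr _)),
        chart_coords (hfr _), P.zero, ← P.zero, rndv_rndv hδ hε' hδε, ← P.zero t, ← P.tame₂ t,
        kap_zero hε]
    · rw [hβr]
  · simp only [hH', hα', kap_one hδ hδ', if_pos (hS' _ _ (hr t) ht)]
    split_ifs with h1
    · exact P.one _ h1
    · exact (hz _ (hS' _ _ (hr t) ht) h1).1.one _
  · have h1 : rndv δ t ∈ skel K n := Or.inl (hK _ _ (hr t) ht)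
    simp only [hα', if_pos h1, htr]
    exact P.eq t ht
  · have h0 : rndv δ t ∈ K := hK _ _ (hr t) ht
    have h1 : rndv δ t ∈ skel K n := Or.inl h0
    simp only [hH', if_pos h1, if_pos (hS' _ _ (hr t) (Or.inl ht))]
    rw [P.eq₂ _ h0, hβr]

/-- Lifting over the whole lattice, relative to a subcomplex. -/
theorem exists_lattice_lift [Nonempty X] [Nonempty Y] (hε : 0 < ε) (hε' : ε ≤ 1 / 4)
    (hA : ∀ r t, Face r t → A r ⊆ A t) (hB : ∀ r t, Face r t → B r ⊆ B t)
    (hK : ∀ r t, Face r t → t ∈ K → r ∈ K)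
    (hs : ∀ ε, 0 < ε → ε ≤ 1 / 4 → ∃ δ, 0 < δ ∧ δ ≤ ε ∧
      ∀ t, SolvableOn (dirs (cell t)) φ (A t) (B t) ε δ)
    (tβ : ∀ t, β (rndv ε t) = β t) (sβ : PlotOn β univ) (hβ : ∀ t, β t ∈ B t)
    (tα : ∀ t, α₀ (rndv ε t) = α₀ t) (sα : PlotOn α₀ {t | rndv ε t ∈ K})
    (hα : ∀ t ∈ K, α₀ t ∈ A t) (hαβ : ∀ t ∈ K, β t = φ (α₀ t)) :
    ∃ (α : (ι → ℝ) → X) (H : (ι → ℝ) → ℝ → Y), PlotOn α univ ∧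
      PlotOn (fun p : (ι → ℝ) × ℝ => H p.1 p.2) univ ∧ (∀ t, H t 0 = β t) ∧
      (∀ t, H t 1 = φ (α t)) ∧ (∀ t ∈ K, α t = α₀ t) ∧ ∀ t ∈ K, ∀ s, H t s = β t := by
  have key : ∀ n, ∃ η, 0 < η ∧ η ≤ 1 / 4 ∧ ∃ α H, PartialLift φ A B K α₀ β n η α H := by
    intro n
    induction n with
    | zero =>
      have h0 : skel K 0 = K := by ext t; simp [skel]
      refine ⟨ε, hε, hε', α₀, fun t _ => β t, tα, fun t _ => tβ t, ?_, ?_, ?_, ?_, fun _ => rfl, ?_,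
        fun _ _ => rfl, fun _ _ _ => rfl⟩
      · rwa [h0]
      · exact (sβ.comp (g := Prod.fst) contDiff_fst (mapsTo_univ _ univ)).mono (subset_univ _)
      · rwa [h0]
      · exact fun t _ _ => hβ t
      · rwa [h0]
    | succ n ih =>
      obtain ⟨η, hη, hη', α, H, P⟩ := ih
      obtain ⟨δ, hδ, hδη, hδs⟩ := hs η hη hη'
      exact ⟨δ, hδ, hδη.trans hη', P.exists_succ hη hη' hA hB hK sβ hβ hδ hδη hδs⟩
  obtain ⟨η, -, -, α, H, P⟩ := key (Fintype.card ι + 1)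
  have hall : ∀ t, t ∈ skel K (Fintype.card ι + 1) := fun t =>
    Or.inr (Nat.lt_succ_of_le (Finset.card_le_univ _))
  exact ⟨α, H, P.smooth.mono fun t _ => hall _, P.smooth₂.mono fun p _ => hall _, P.zero,
    fun t => P.one t (hall t), P.eq, P.eq₂⟩

end Skeleta

/-! ### A staircase reparametrization -/

section Staircase

/-- A staircase function from `[0, m + 2]` to `[0, 1]` that is locally constant near integers. -/
noncomputable def lam (m : ℕ) (t : ℝ) : ℝ :=
  (∑ j ∈ Finset.range m, sg (1 / 4) (t - (j + 1))) / m

variable {m : ℕ} {t : ℝ}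

theorem contDiff_lam (m : ℕ) : ContDiff ℝ ∞ (lam m) :=
  (ContDiff.sum fun _ _ => (contDiff_sg _).comp (contDiff_id.sub contDiff_const)).div_const _

theorem lam_of_le (h : t ≤ 9 / 8) : lam m t = 0 := by
  rw [lam, Finset.sum_eq_zero, zero_div]
  intro j _
  have : (0 : ℝ) ≤ j := Nat.cast_nonneg j
  exact sg_of_le quarter_pos le_rfl (by linarith)

theorem lam_of_ge (hm : 0 < m) (h : m + 7 / 8 ≤ t) : lam m t = 1 := by
  have hm' : (m : ℝ) ≠ 0 := by positivity
  rw [lam, Finset.sum_congr rfl (g := fun _ => (1 : ℝ)), Finset.sum_const, Finset.card_range,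
    nsmul_eq_mul, mul_one, div_self hm']
  intro j hj
  have : (j : ℝ) + 1 ≤ m := by exact_mod_cast Finset.mem_range.1 hj
  exact sg_of_ge quarter_pos le_rfl (by linarith)

theorem lam_mem (hm : 0 < m) (t : ℝ) : lam m t ∈ Icc (0 : ℝ) 1 := by
  have hm' : (0 : ℝ) < m := by positivity
  refine ⟨div_nonneg (Finset.sum_nonneg fun j _ => (sg_mem quarter_pos le_rfl _).1) hm'.le, ?_⟩
  rw [lam, div_le_one hm']
  calc _ ≤ ∑ j ∈ Finset.range m, (1 : ℝ) :=
        Finset.sum_le_sum fun j _ => (sg_mem quarter_pos le_rfl _).2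
    _ = m := by simp

theorem sg_rnd (s : ℝ) : sg (1 / 4) (rnd (1 / 8) s) = sg (1 / 4) s := by
  have h8 : (0 : ℝ) < 1 / 8 := by norm_num
  have hm := kap_mem h8 (by norm_num) (Int.fract s)
  have h2 := Int.floor_add_fract s
  have h3 := Int.fract_lt_one s
  have h4 := Int.fract_nonneg s
  rcases lt_trichotomy ⌊s⌋ 0 with h | h | h
  · have : (⌊s⌋ : ℝ) ≤ -1 := by
      have h' : ⌊s⌋ ≤ -1 := by omega
      exact_mod_cast h'
    rw [sg_of_le quarter_pos le_rfl (by rw [rnd]; linarith [hm.2]),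
      sg_of_le quarter_pos le_rfl (by linarith)]
  · have hs : Int.fract s = s := by rw [Int.fract, h]; simp
    rw [rnd, h, hs, Int.cast_zero, zero_add, sg_kap h8 (by norm_num) le_rfl]
  · have : (1 : ℝ) ≤ ⌊s⌋ := by exact_mod_cast h
    rw [sg_of_ge quarter_pos le_rfl (by rw [rnd]; linarith [hm.1]),
      sg_of_ge quarter_pos le_rfl (by linarith)]

theorem lam_rnd (m : ℕ) (t : ℝ) : lam m (rnd (1 / 8) t) = lam m t := by
  rw [lam, lam]
  congr 1
  refine Finset.sum_congr rfl fun j _ => ?_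
  rw [← sg_rnd (t - (j + 1))]
  congr 1
  have e : t - ((j : ℝ) + 1) = t - ((j + 1 : ℕ) : ℝ) := by push_cast; rfl
  rw [e, rnd, rnd, Int.floor_sub_natCast, Int.fract_sub_natCast]
  push_cast; ring

/-- On a unit interval between integers at most one summand varies, and by at most `1`. -/
theorem abs_lam_sub_le (hm : 0 < m) {a : ℤ} {t t' : ℝ} (ht : t ∈ Icc (a : ℝ) (a + 1))
    (ht' : t' ∈ Icc (a : ℝ) (a + 1)) : |lam m t - lam m t'| ≤ 1 / m := by
  have hm' : (0 : ℝ) < m := by positivity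
  rw [lam, lam, ← sub_div, abs_div, abs_of_pos hm', ← Finset.sum_sub_distrib]
  gcongr
  calc _ ≤ ∑ j ∈ Finset.range m, |sg (1 / 4) (t - (j + 1)) - sg (1 / 4) (t' - (j + 1))| :=
        Finset.abs_sum_le_sum_abs _ _
    _ ≤ ∑ j ∈ Finset.range m, if j = (a - 1).toNat then (1 : ℝ) else 0 := by
        refine Finset.sum_le_sum fun j _ => ?_
        have h1 := sg_mem quarter_pos le_rfl (t - (j + 1))
        have h2 := sg_mem quarter_pos le_rfl (t' - (j + 1))
        rcases lt_trichotomy ((j : ℤ) + 1) a with h | h | h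
        · have h' : (j : ℝ) + 1 + 1 ≤ a := by exact_mod_cast h
          rw [sg_of_ge quarter_pos le_rfl (by linarith [ht.1]),
            sg_of_ge quarter_pos le_rfl (by linarith [ht'.1]), sub_self, abs_zero]
          split_ifs <;> norm_num
        · rw [if_pos (by omega), abs_le]
          constructor <;> linarith [h1.1, h1.2, h2.1, h2.2]
        · have h' : (a : ℝ) + 1 ≤ (j : ℝ) + 1 := by exact_mod_cast h
          rw [sg_of_le quarter_pos le_rfl (by linarith [ht.2]),
            sg_of_le quarter_pos le_rfl (by linarith [ht'.2]), sub_self, abs_zero]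
          split_ifs <;> norm_num
    _ ≤ 1 := by
        rw [Finset.sum_ite_eq']
        split_ifs <;> norm_num

end Staircase

/-! ### Subdivision and lifting for excisive triads -/

section Excision

variable {ι X Y : Type*} [Fintype ι] [DiffeologicalSpace X] [DiffeologicalSpace Y] {φ : X → Y}
  {ε : ℝ}

theorem PlotOn.isOpen_preimage {f : (ι → ℝ) → X} (hf : PlotOn f univ) {U : Set X}
    (hU : @IsOpen X dTopology U) : IsOpen (f ⁻¹' U) := by
  set e := Fintype.equivFin ι
  have hp : ContDiff ℝ ∞ fun (z : EuclideanSpace ℝ (Fin (Fintype.card ι))) (i : ι) => z (e i) :=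
    contDiff_fromCube e
  have h := isOpen_iff_preimages_plots.1 hU _ _ (hf _ hp fun _ => mem_univ _)
  have hq : Continuous fun t : ι → ℝ => WithLp.toLp 2 fun j => t (e.symm j) := by fun_prop
  convert h.preimage hq using 1
  ext t
  simp

/-- Smooth maps pull D-open sets back to open sets, so the two interiors induce an open cover of the
compact unit cube, which has a Lebesgue number. -/
theorem exists_lebesgue {A₁ A₂ : Set X} (hX : IsExcisiveTriad A₁ A₂) {f : (ι → ℝ) → X}
    (hf : PlotOn f univ) : ∃ δ > 0, ∀ S : Set (ι → ℝ), (∀ x ∈ S, ∀ i, x i ∈ Icc (0 : ℝ) 1) →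
      (∀ x ∈ S, ∀ y ∈ S, dist x y < δ) →
      ∃ b : Bool, ∀ x ∈ S, f x ∈ if b then A₁ else A₂ := by
  have hc : IsCompact (Set.pi univ fun _ : ι => Icc (0 : ℝ) 1) :=
    isCompact_univ_pi fun _ => isCompact_Icc
  obtain ⟨δ, hδ, h⟩ := lebesgue_number_lemma_of_metric hc
    (c := fun b : Bool => f ⁻¹' (if b then @interior X dTopology A₁ else @interior X dTopology A₂))
    (fun b => by
      cases b
      · exact hf.isOpen_preimage (@isOpen_interior X dTopology A₂)
      · exact hf.isOpen_preimage (@isOpen_interior X dTopology A₁))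
    (fun t _ => by
      have : f t ∈ @interior X dTopology A₁ ∪ @interior X dTopology A₂ := by
        rw [show _ ∪ _ = univ from hX]; trivial
      rcases this with h | h
      · exact mem_iUnion.2 ⟨true, h⟩
      · exact mem_iUnion.2 ⟨false, h⟩)
  refine ⟨δ, hδ, fun S hS hd => ?_⟩
  rcases S.eq_empty_or_nonempty with rfl | ⟨x, hx⟩
  · exact ⟨true, fun x hx => absurd hx (notMem_empty x)⟩
  obtain ⟨b, hb⟩ := h x fun i _ => hS x hx i
  refine ⟨b, fun y hy => ?_⟩
  have := hb (Metric.mem_ball.2 (hd y hy x hx))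
  cases b
  · exact @interior_subset X dTopology A₂ _ this
  · exact @interior_subset X dTopology A₁ _ this

open Classical in
/-- On a fine lattice, every lattice cube can be labelled by one of the two parts of the triads. -/
theorem exists_labels {A₁ A₂ : Set X} {B₁ B₂ : Set Y} (hX : IsExcisiveTriad A₁ A₂)
    (hY : IsExcisiveTriad B₁ B₂) (h₁ : MapsTo φ A₁ B₁) (h₂ : MapsTo φ A₂ B₂) (hε : 0 < ε)
    {α : (ι → ℝ) → X} {β : (ι → ℝ) → Y} (sα : PlotOn α (col ι ε)) (sβ : PlotOn β univ)
    (hαβ : ∀ t ∈ col ι ε, β t = φ (α t)) :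
    ∃ m : ℕ, 0 < m ∧ ∀ a : ι → ℤ, ∃ b : Bool, ∀ t : ι → ℝ,
      (∀ i, t i ∈ Icc (a i : ℝ) (a i + 1)) →
      β (fun i => lam m (t i)) ∈ (if b then B₁ else B₂) ∧
      ((∃ i, t i ≤ 0 ∨ m + 2 ≤ t i) → α (fun i => lam m (t i)) ∈ if b then A₁ else A₂) := by
  -- `α` is controlled only near the boundary. Composing it with the projection onto each face of
  -- the cube gives maps on the whole space, to which the Lebesgue argument applies.
  have hup : ∀ q : ι × Bool, PlotOn (fun t => α (Function.update t q.1 (if q.2 then 1 else 0)))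
      univ := fun q => sα.comp (g := fun t => Function.update t q.1 (if q.2 then 1 else 0))
    (contDiff_pi.2 fun i => by
      by_cases h : i = q.1
      · subst h
        simpa using contDiff_const
      · simpa [Function.update_of_ne h] using contDiff_apply ℝ ℝ i) fun t _ =>
      mem_col_of_boundary hε ⟨q.1, by cases q.2 <;> simp⟩
  choose δ hδ hL using fun q => exists_lebesgue hX (hup q)
  obtain ⟨η, hη, hLβ⟩ := exists_lebesgue hY sβ
  have hev : ∀ d : ℝ, 0 < d → ∀ᶠ m : ℕ in Filter.atTop, 1 / (m : ℝ) < d := fun d hd =>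
    tendsto_one_div_atTop_nhds_zero_nat.eventually (gt_mem_nhds hd)
  obtain ⟨m, hm0, hmη, hmδ⟩ := ((Filter.eventually_gt_atTop 0).and ((hev η hη).and
    (Filter.eventually_all.2 fun q => hev (δ q) (hδ q)))).exists
  refine ⟨m, hm0, fun a => ?_⟩
  set S : Set (ι → ℝ) := (fun (t : ι → ℝ) i => lam m (t i)) ''
    {t | ∀ i, t i ∈ Icc (a i : ℝ) (a i + 1)}
    with hS
  have hS1 : ∀ x ∈ S, ∀ i, x i ∈ Icc (0 : ℝ) 1 := by
    rintro _ ⟨t, -, rfl⟩ i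
    exact lam_mem hm0 _
  have hS2 : ∀ d, 1 / (m : ℝ) < d → ∀ x ∈ S, ∀ y ∈ S, dist x y < d := by
    rintro d hd _ ⟨t, ht, rfl⟩ _ ⟨t', ht', rfl⟩
    refine (dist_pi_lt_iff (lt_of_le_of_lt (by positivity) hd)).2 fun i => ?_
    rw [Real.dist_eq]
    exact (abs_lam_sub_le hm0 (ht i) (ht' i)).trans_lt hd
  -- `lam` is constant on the first and last unit intervals of `[0, m + 2]` and beyond, so these
  -- boxes map into a face. They must be labelled through `α`, because `β` landing in `B₁` does not
  -- put `α` in `A₁`; the label passes to `β = φ ∘ α`. Other boxes do not meet the region where `α`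
  -- is constrained.
  by_cases ha : ∃ i, a i ≤ 0 ∨ (m : ℤ) + 1 ≤ a i
  · obtain ⟨q, hq⟩ : ∃ q : ι × Bool, ∀ t : ι → ℝ, (∀ i, t i ∈ Icc (a i : ℝ) (a i + 1)) →
        lam m (t q.1) = if q.2 then 1 else 0 := by
      obtain ⟨i, hi | hi⟩ := ha
      · refine ⟨(i, false), fun t ht => ?_⟩
        have : (a i : ℝ) ≤ 0 := by exact_mod_cast hi
        rw [lam_of_le (by linarith [(ht i).2])]
        simp
      · refine ⟨(i, true), fun t ht => ?_⟩
        have : (m : ℝ) + 1 ≤ a i := by exact_mod_cast hi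
        rw [lam_of_ge hm0 (by linarith [(ht i).1])]
        simp
    obtain ⟨b, hb⟩ := hL q S hS1 (hS2 _ (hmδ q))
    refine ⟨b, fun t ht => ?_⟩
    have h := hb _ ⟨t, ht, rfl⟩
    rw [← hq t ht, Function.update_eq_self_iff.2 rfl] at h
    refine ⟨?_, fun _ => h⟩
    rw [hαβ _ (mem_col_of_boundary hε ⟨q.1, by rw [hq t ht]; cases q.2 <;> simp⟩)]
    cases b
    · exact h₂ h
    · exact h₁ h
  · obtain ⟨b, hb⟩ := hLβ S hS1 (hS2 _ hmη)
    refine ⟨b, fun t ht => ⟨hb _ ⟨t, ht, rfl⟩, fun ⟨i, hi⟩ => absurd ⟨i, hi.imp (fun h => ?_)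
      fun h => ?_⟩ ha⟩⟩
    · exact_mod_cast (ht i).1.trans h
    · have : (m : ℝ) + 1 ≤ a i := by linarith [(ht i).2]
      exact_mod_cast this

/-- There are infinitely many lattice cells but only finitely many pairs of a target and a set of
directions, so a minimum exists. -/
theorem exists_uniform_solvableOn {κ : Type*} [Finite κ] [Nonempty κ] {A : κ → Set X}
    {B : κ → Set Y} (hs : ∀ c (J : Finset ι) ε, 0 < ε → ε ≤ 1 / 4 →
      ∃ δ, 0 < δ ∧ δ ≤ ε ∧ SolvableOn J φ (A c) (B c) ε δ) (ε : ℝ) (hε : 0 < ε) (hε' : ε ≤ 1 / 4) :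
    ∃ δ, 0 < δ ∧ δ ≤ ε ∧ ∀ c (J : Finset ι), SolvableOn J φ (A c) (B c) ε δ := by
  choose δ h0 hδ h using fun q : κ × Finset ι => hs q.1 q.2 ε hε hε'
  obtain ⟨q, hq⟩ := Finite.exists_min δ
  exact ⟨δ q, h0 q, hδ q, fun c J => (h (c, J)).mono (h0 q) ((hδ _).trans hε') (hq _)⟩

/-- Lifting of cubes, up to a reparametrization of the cube. -/
def CubeLiftProp (ι : Type*) [Fintype ι] (φ : X → Y) : Prop :=
  ∀ ⦃ε : ℝ⦄, 0 < ε → ∀ ⦃α : (ι → ℝ) → X⦄ ⦃β : (ι → ℝ) → Y⦄, PlotOn α (col ι ε) → PlotOn β univ →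
    (∀ t ∈ col ι ε, β t = φ (α t)) →
    ∃ μ : ℝ → ℝ, ContDiff ℝ ∞ μ ∧ (∀ s, μ s ∈ Icc (0 : ℝ) 1) ∧ μ 0 = 0 ∧ μ 1 = 1 ∧
      ∃ (α' : (ι → ℝ) → X) (H : (ι → ℝ) → ℝ → Y), PlotOn α' univ ∧
        PlotOn (fun p : (ι → ℝ) × ℝ => H p.1 p.2) univ ∧ (∀ t, H t 0 = β fun i => μ (t i)) ∧
        (∀ t, H t 1 = φ (α' t)) ∧ ∀ t, (∃ i, t i = 0 ∨ t i = 1) →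
          α' t = α (fun i => μ (t i)) ∧ ∀ s, H t s = β fun i => μ (t i)

/-- Lifting of cubes along a map of excisive triads. -/
theorem IsExcisiveTriad.cubeLiftProp [Nonempty X] {A₁ A₂ : Set X} {B₁ B₂ : Set Y}
    (hX : IsExcisiveTriad A₁ A₂) (hY : IsExcisiveTriad B₁ B₂)
    (h₁ : MapsTo φ A₁ B₁) (h₂ : MapsTo φ A₂ B₂)
    (hw₁ : IsWeakHomotopyEquivalence (h₁.restrict φ A₁ B₁))
    (hw₂ : IsWeakHomotopyEquivalence (h₂.restrict φ A₂ B₂))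
    (hw₁₂ : IsWeakHomotopyEquivalence ((h₁.inter_inter h₂).restrict φ (A₁ ∩ A₂) (B₁ ∩ B₂))) :
    CubeLiftProp ι φ := by
  intro ε hε α β sα sβ hαβ
  have : Nonempty Y := ⟨β 0⟩
  obtain ⟨m, hm, hlab⟩ := exists_labels hX hY h₁ h₂ hε sα sβ hαβ
  choose b hb using hlab
  set K : Set (ι → ℝ) := {t | ∃ i, t i ≤ 0 ∨ m + 2 ≤ t i} with hK
  set box : (ι → ℤ) → Set (ι → ℝ) := fun a => {t | ∀ i, t i ∈ Icc (a i : ℝ) (a i + 1)} with hbox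
  have hlc : ContDiff ℝ ∞ fun (t : ι → ℝ) i => lam m (t i) :=
    contDiff_pi.2 fun i => (contDiff_lam m).comp (contDiff_apply ℝ ℝ i)
  have h8 : (0 : ℝ) < 1 / 8 := by norm_num
  have hcol : ∀ t, rndv (1 / 8) t ∈ K → (fun i => lam m (t i)) ∈ col ι ε := by
    rintro t ⟨i, hi⟩
    refine mem_col_of_boundary hε ⟨i, hi.imp (fun h => ?_) fun h => ?_⟩
    · rw [← lam_rnd]
      exact lam_of_le (h.trans (by norm_num))
    · rw [← lam_rnd]
      exact lam_of_ge hm (le_trans (by linarith) h)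
  have hface : ∀ r t a, Face r t → t ∈ box a → r ∈ box a := fun r t a hr ht i => by
    have h1 : (a i : ℝ) ≤ ⌊t i⌋ := by exact_mod_cast Int.le_floor.2 (ht i).1
    have h2 : (⌈t i⌉ : ℝ) ≤ a i + 1 := by
      exact_mod_cast Int.ceil_le.2 (by push_cast; exact (ht i).2)
    exact ⟨h1.trans (hr i).1, (hr i).2.trans h2⟩
  have hKf : ∀ r t, Face r t → t ∈ K → r ∈ K := by
    rintro r t hr ⟨i, hi⟩
    refine ⟨i, hi.imp (fun h => (hr i).2.trans ?_) fun h => le_trans ?_ (hr i).1⟩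
    · exact_mod_cast Int.ceil_le.2 (by exact_mod_cast h)
    · have : ((m + 2 : ℤ) : ℝ) ≤ t i := by exact_mod_cast h
      exact_mod_cast Int.le_floor.2 this
  have hself : ∀ t : ι → ℝ, t ∈ box fun i => ⌊t i⌋ := fun t i =>
    ⟨Int.floor_le _, (Int.lt_floor_add_one _).le⟩
  -- A point must be lifted into every part that labels a closed box containing it. A face lies in
  -- all the boxes that contain its cell, so it carries at least as many constraints.
  let A : (ι → ℝ) → Set X := fun t => {x | ∀ a, t ∈ box a → x ∈ if b a then A₁ else A₂}
  let B : (ι → ℝ) → Set Y := fun t => {y | ∀ a, t ∈ box a → y ∈ if b a then B₁ else B₂}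
  let A' : Option Bool → Set X := fun c => c.elim (A₁ ∩ A₂) fun c => if c then A₁ else A₂
  let B' : Option Bool → Set Y := fun c => c.elim (B₁ ∩ B₂) fun c => if c then B₁ else B₂
  have hcases : ∀ t, ∃ c, A t = A' c ∧ B t = B' c := by
    intro t
    by_cases ht : ∃ a, t ∈ box a ∧ b a = true
    · by_cases hf : ∃ a, t ∈ box a ∧ b a = false
      · refine ⟨none, ?_⟩
        obtain ⟨a, ha, hat⟩ := ht
        obtain ⟨a', ha', haf⟩ := hf
        constructor <;> ext x <;> refine ⟨fun h => ⟨?_, ?_⟩, fun h c _ => ?_⟩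
        · simpa [hat] using h a ha
        · simpa [haf] using h a' ha'
        · split_ifs
          exacts [h.1, h.2]
        · simpa [hat] using h a ha
        · simpa [haf] using h a' ha'
        · split_ifs
          exacts [h.1, h.2]
      · refine ⟨some true, ?_⟩
        have hall : ∀ a, t ∈ box a → b a = true := fun a ha => by
          by_contra hne
          exact hf ⟨a, ha, by simpa using hne⟩
        constructor <;> ext x <;> refine ⟨fun h => ?_, fun h c hc => ?_⟩
        · simpa [A', hall _ (hself t)] using h _ (hself t)
        · simpa [A', hall _ hc] using h
        · simpa [B', hall _ (hself t)] using h _ (hself t)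
        · simpa [B', hall _ hc] using h
    · refine ⟨some false, ?_⟩
      have hall : ∀ a, t ∈ box a → b a = false := fun a ha => by
        by_contra hne
        exact ht ⟨a, ha, by simpa using hne⟩
      constructor <;> ext x <;> refine ⟨fun h => ?_, fun h c hc => ?_⟩
      · simpa [A', hall _ (hself t)] using h _ (hself t)
      · simpa [A', hall _ hc] using h
      · simpa [B', hall _ (hself t)] using h _ (hself t)
      · simpa [B', hall _ hc] using h
  have hsolve := exists_uniform_solvableOn (ι := ι) (φ := φ) (A := A') (B := B') (by
    rintro (_ | _ | _) J η hη hη'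
    · exact exists_solvableOn (h₁.inter_inter h₂) hw₁₂ hη hη'
    · exact exists_solvableOn h₂ hw₂ hη hη'
    · exact exists_solvableOn h₁ hw₁ hη hη')
  obtain ⟨α', H, s1, s2, H0, H1, e1, e2⟩ := exists_lattice_lift (φ := φ) (ε := 1 / 8) (A := A)
    (B := B) (K := K) (α₀ := fun t => α fun i => lam m (t i)) (β := fun t => β fun i => lam m (t i))
    h8 (by norm_num) (fun r t hr x hx a ha => hx a (hface r t a hr ha))
    (fun r t hr x hx a ha => hx a (hface r t a hr ha)) hKf
    (fun η hη hη' => by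
      obtain ⟨δ, hδ, hδη, h⟩ := hsolve η hη hη'
      refine ⟨δ, hδ, hδη, fun t => ?_⟩
      obtain ⟨c, hA, hB⟩ := hcases t
      rw [hA, hB]
      exact h c _)
    (fun t => congrArg β (funext fun i => lam_rnd m (t i)))
    (sβ.comp hlc (mapsTo_univ _ _)) (fun t a ha => (hb a t ha).1)
    (fun t => congrArg α (funext fun i => lam_rnd m (t i)))
    (sα.comp hlc hcol) (fun t ht a ha => (hb a t ha).2 ht)
    (fun t ht => hαβ _ (hcol t (hKf _ _ (face_rndv h8 (by norm_num) t) ht)))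
  -- Rescaling returns from `[0, m + 2]` to the unit cube, whose boundary goes into `K`.
  have hsc : ContDiff ℝ ∞ fun (t : ι → ℝ) => ((m : ℝ) + 2) • t :=
    contDiff_id.const_smul ((m : ℝ) + 2)
  refine ⟨fun s => lam m ((m + 2) * s), (contDiff_lam m).comp (contDiff_const.mul contDiff_id),
    fun s => lam_mem hm _, ?_, ?_, fun t => α' (((m : ℝ) + 2) • t),
    fun t s => H (((m : ℝ) + 2) • t) s, s1.comp hsc (mapsTo_univ _ _),
    s2.comp (g := fun p : (ι → ℝ) × ℝ => (((m : ℝ) + 2) • p.1, p.2))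
      ((hsc.comp contDiff_fst).prodMk contDiff_snd) (mapsTo_univ _ _), fun t => H0 _, fun t => H1 _,
    fun t ⟨i, hi⟩ => ?_⟩
  · exact lam_of_le (by norm_num)
  · exact lam_of_ge hm (by linarith)
  · have hmem : ((m : ℝ) + 2) • t ∈ K := by
      refine ⟨i, hi.imp (fun h => ?_) fun h => ?_⟩ <;> simp [h]
    exact ⟨e1 _ hmem, e2 _ hmem⟩

end Excision

/-! ### From lifting of cubes to homotopy sets -/

section HomotopySets

variable {ι X Y : Type*} [DiffeologicalSpace X] [DiffeologicalSpace Y] {φ : X → Y} {k : ℕ}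

/-- The self-map of the standard cube that applies a function to each coordinate. -/
def cubeMap {ν : ℝ → ℝ} (h : ∀ s, ν s ∈ Icc (0 : ℝ) 1) (z : cube k) : cube k :=
  ⟨WithLp.toLp 2 fun j => ν ((z : EuclideanSpace ℝ (Fin k)) j), fun _ => h _⟩

/-- The straight-line homotopy from the identity to the reparametrization fixes coordinates equal to
0 or 1, hence keeps each face in itself. -/
theorem pairHomotopic_cubeMap {ν : ℝ → ℝ} (hν : ContDiff ℝ ∞ ν) (h : ∀ s, ν s ∈ Icc (0 : ℝ) 1)
    (h0 : ν 0 = 0) (h1 : ν 1 = 1) {B : Set X} {f g : PairMap (cubeBoundary k) B}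
    (hg : ∀ z, g.1 z = f.1 (cubeMap h z)) : PairHomotopic f g := by
  have hmem : ∀ (z : cube k) (s : unitInterval) (j : Fin k),
      (1 - (s : ℝ)) * (z : EuclideanSpace ℝ (Fin k)) j +
        s * ν ((z : EuclideanSpace ℝ (Fin k)) j) ∈ Icc (0 : ℝ) 1 := fun z s j =>
    (convex_Icc (0 : ℝ) 1) (z.2 j) (h _) (sub_nonneg.2 s.2.2) s.2.1 (by ring)
  let m : cube k × unitInterval → cube k := fun q =>
    ⟨WithLp.toLp 2 fun j => (1 - (q.2 : ℝ)) * (q.1 : EuclideanSpace ℝ (Fin k)) j +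
      q.2 * ν ((q.1 : EuclideanSpace ℝ (Fin k)) j), hmem q.1 q.2⟩
  have hm : DSmooth m := fun n p hp => by
    have c1 := (isPlot_subtype.1 hp.1).contDiff
    have c2 := (isPlot_subtype.1 hp.2).contDiff
    refine isPlot_subtype.2 (ContDiff.isPlot ((contDiff_piLp 2).2 fun j => ?_))
    have c3 := (contDiff_piLp 2).1 c1 j
    exact ((contDiff_const.sub c2).mul c3).add (c2.mul (hν.comp c3))
  refine ⟨f.1 ∘ m, f.2.1.comp hm, fun z => congrArg f.1 (Subtype.ext ?_), fun z => ?_,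
    fun z ⟨j, hj⟩ s => f.2.2 ⟨j, hj.imp (fun h => ?_) fun h => ?_⟩⟩
  · ext j
    simp [m]
  · rw [hg]
    refine congrArg f.1 (Subtype.ext ?_)
    ext j
    simp [m, cubeMap]
  · simp [m, h, h0]
  · simp [m, h, h1]

theorem toCube_comp_fromCube (e : ι ≃ Fin k) {μ : ℝ → ℝ} (z : cube k) :
    toCube e (fun i => μ (fromCube e z i)) =
      cubeMap (ν := fun s => sg (1 / 4) (μ s)) (fun _ => sg_mem quarter_pos le_rfl _) z := by
  refine Subtype.ext ?_
  ext j
  simp [toCube, fromCube, cubeMap]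

theorem eighth_pos : (0 : ℝ) < 1 / 8 := by norm_num

variable [Fintype ι]

/-- A representative in `Y` is lifted with constant boundary map `x`; the reparametrization does not
change its class. -/
theorem CubeLiftProp.surjective (h : CubeLiftProp ι φ) (e : ι ≃ Fin k) (hφ : DSmooth φ) (x : X) :
    Function.Surjective (HomotopySet.map k φ hφ x) := by
  intro q
  obtain ⟨g, rfl⟩ := Quot.exists_rep q
  have hg : ∀ t ∈ col ι (1 / 8), g.1 (toCube e t) = φ x := fun t ht =>
    g.2.2 (toCube_mem_boundary e le_rfl ht)
  obtain ⟨μ, hμ, hμm, μ0, μ1, α', H, s1, s2, H0, H1, hb⟩ := h eighth_pos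
    (plotOn_const x (col ι (1 / 8))) (g.2.1.plotOn_toCube e) hg
  have hcol : ∀ z ∈ cubeBoundary k, (fun i => μ (fromCube e z i)) ∈ col ι (1 / 8) := fun z hz => by
    obtain ⟨i, hi⟩ := fromCube_boundary e hz
    exact mem_col_of_boundary eighth_pos
      ⟨i, hi.imp (fun h => by rw [h, μ0]) fun h => by rw [h, μ1]⟩
  let f : PairMap (cubeBoundary k) ({x} : Set X) := ⟨fun z => α' (fromCube e z),
    s1.dSmooth_fromCube e, fun z hz => (hb _ (fromCube_boundary e hz)).1⟩
  let g' : PairMap (cubeBoundary k) ({φ x} : Set Y) := ⟨fun z => H (fromCube e z) 0,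
    (s2.comp (contDiff_id.prodMk contDiff_const) (mapsTo_univ _ univ)).dSmooth_fromCube e,
    fun z hz => ((hb _ (fromCube_boundary e hz)).2 0).trans (hg _ (hcol z hz))⟩
  refine ⟨Quot.mk _ f, ?_⟩
  have hν0 : sg (1 / 4) (μ 0) = 0 := by rw [μ0, sg_zero quarter_pos le_rfl]
  have hν1 : sg (1 / 4) (μ 1) = 1 := by rw [μ1, sg_one quarter_pos le_rfl]
  have e1 : PairHomotopic g g' := pairHomotopic_cubeMap ((contDiff_sg _).comp hμ)
    (fun _ => sg_mem quarter_pos le_rfl _) hν0 hν1 fun z =>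
      (H0 _).trans (congrArg g.1 (toCube_comp_fromCube e z))
  rw [Quot.sound e1]
  refine (Quot.sound ⟨fun q => H (fromCube e q.1) q.2, s2.dSmooth_fromCube_prod e, fun z => rfl,
    fun z => H1 _, fun z hz s => ?_⟩).symm
  exact ((hb _ (fromCube_boundary e hz)).2 _).trans (hg _ (hcol z hz))

/-- A homotopy in `Y` between `φ ∘ a` and `φ ∘ b` is a cube of one dimension more, with boundary
lifted by `a` at the bottom, `b` at the top and `x` on the sides. Its lift is a homotopy between
reparametrizations of `a` and `b`. -/
theorem CubeLiftProp.injective (h : CubeLiftProp (Option ι) φ) (e : ι ≃ Fin k) (hφ : DSmooth φ)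
    (x : X) : Function.Injective (HomotopySet.map k φ hφ x) := by
  classical
  intro p q hpq
  obtain ⟨a, rfl⟩ := Quot.exists_rep p
  obtain ⟨b, rfl⟩ := Quot.exists_rep q
  obtain ⟨F, hF, h0, h1, hA⟩ := pairHomotopic_of_eq hpq
  set α : (Option ι → ℝ) → X := fun u =>
    if u none < 1 / 2 then a.1 (toCube e (otail u)) else b.1 (toCube e (otail u)) with hα
  have αa : ∀ u : Option ι → ℝ, u none < 1 / 8 → α u = a.1 (toCube e (otail u)) := fun u hu =>
    if_pos (by linarith)
  have αb : ∀ u : Option ι → ℝ, 1 - 1 / 8 < u none → α u = b.1 (toCube e (otail u)) :=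
    fun u hu => if_neg (by linarith)
  have αx : ∀ u, otail u ∈ col ι (1 / 8) → α u = x := fun u hu => by
    have hz := toCube_mem_boundary e le_rfl hu
    simp only [hα]
    rw [show a.1 _ = x from a.2.2 hz, show b.1 _ = x from b.2.2 hz, ite_self]
  obtain ⟨μ, hμ, hμm, μ0, μ1, α', H, s1, -, -, -, hb⟩ := h eighth_pos (α := α)
    (β := fun u => F (toCube e (otail u), sgI (u none)))
    (by
      have c1 : Continuous fun u : Option ι → ℝ => otail u := contDiff_otail.continuous
      have c2 : Continuous fun u : Option ι → ℝ => u none := continuous_apply none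
      refine PlotOn.mono (U := ({u : Option ι → ℝ | otail u ∈ col ι (1 / 8)} ∪
        {u | u none < 1 / 8}) ∪ {u | 1 - 1 / 8 < u none}) (PlotOn.union ?_ ?_
          (PlotOn.union ?_ ?_ ?_ ?_) ?_) (fun u hu => mem_col_option.1 hu)
      · exact ((isOpen_col _).preimage c1).union (isOpen_lt c2 continuous_const)
      · exact isOpen_lt continuous_const c2
      · exact (isOpen_col _).preimage c1
      · exact isOpen_lt c2 continuous_const
      · exact (plotOn_const x _).congr αx
      · exact ((a.2.1.plotOn_toCube e).comp contDiff_otail (mapsTo_univ _ _)).congr αa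
      · exact ((b.2.1.plotOn_toCube e).comp contDiff_otail (mapsTo_univ _ _)).congr αb)
    ((hF.plotOn_toCube_prod e).comp (g := fun u : Option ι → ℝ => (otail u, u none))
      (contDiff_otail.prodMk (contDiff_apply ℝ ℝ none)) (mapsTo_univ _ _))
    (fun u hu => by
      rw [mem_col_option] at hu
      rcases hu with (hu | hu) | hu
      · rw [αx u hu]
        exact hA _ (toCube_mem_boundary e le_rfl hu) _
      · rw [αa u hu, show sgI (u none) = 0 from
          Subtype.ext (sg_of_le quarter_pos le_rfl (by linarith)), h0]
        rfl
      · rw [αb u hu, show sgI (u none) = 1 from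
          Subtype.ext (sg_of_ge quarter_pos le_rfl (by linarith)), h1]
        rfl)
  have hbd : ∀ z ∈ cubeBoundary k, ∀ s, α' (ocons (fromCube e z) s) = x := fun z hz s => by
    obtain ⟨i, hi⟩ := fromCube_boundary e hz
    refine (hb (ocons (fromCube e z) s) ⟨some i, hi⟩).1.trans (αx
      (fun j => μ (ocons (fromCube e z) s j)) (mem_col_of_boundary eighth_pos
        ⟨i, hi.imp (fun h => (congrArg μ h).trans μ0) fun h => (congrArg μ h).trans μ1⟩))
  have hs : PlotOn (fun p : (ι → ℝ) × ℝ => α' (ocons p.1 p.2)) univ :=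
    s1.comp contDiff_ocons (mapsTo_univ _ _)
  let c : ℝ → PairMap (cubeBoundary k) ({x} : Set X) := fun s =>
    ⟨fun z => α' (ocons (fromCube e z) s),
      (hs.comp (contDiff_id.prodMk contDiff_const) (mapsTo_univ _ univ)).dSmooth_fromCube e,
      fun z hz => hbd z hz s⟩
  have hν0 : sg (1 / 4) (μ 0) = 0 := by rw [μ0, sg_zero quarter_pos le_rfl]
  have hν1 : sg (1 / 4) (μ 1) = 1 := by rw [μ1, sg_one quarter_pos le_rfl]
  have ea : PairHomotopic a (c 0) := pairHomotopic_cubeMap ((contDiff_sg _).comp hμ)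
    (fun _ => sg_mem quarter_pos le_rfl _) hν0 hν1 fun z => by
      refine (hb (ocons (fromCube e z) 0) ⟨none, Or.inl rfl⟩).1.trans
        ((αa (fun j => μ (ocons (fromCube e z) 0 j)) ?_).trans ?_)
      · exact (congrArg (· < (1 / 8 : ℝ)) μ0).mpr eighth_pos
      · exact congrArg a.1 (toCube_comp_fromCube e z)
  have eb : PairHomotopic b (c 1) := pairHomotopic_cubeMap ((contDiff_sg _).comp hμ)
    (fun _ => sg_mem quarter_pos le_rfl _) hν0 hν1 fun z => by
      refine (hb (ocons (fromCube e z) 1) ⟨none, Or.inr rfl⟩).1.trans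
        ((αb (fun j => μ (ocons (fromCube e z) 1 j)) ?_).trans ?_)
      · exact (congrArg ((1 - 1 / 8 : ℝ) < ·) μ1).mpr (by norm_num)
      · exact congrArg b.1 (toCube_comp_fromCube e z)
  have ec : PairHomotopic (c 0) (c 1) := ⟨fun q => α' (ocons (fromCube e q.1) q.2),
    hs.dSmooth_fromCube_prod e, fun z => rfl, fun z => rfl, fun z hz s => hbd z hz s⟩
  exact (Quot.sound ea).trans ((Quot.sound ec).trans (Quot.sound eb).symm)

/-- Every point of `Y` lies in `B₁` or `B₂`, where it is joined to the image of a point. This is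
separate from the cube argument because `X` is not known to be nonempty here. -/
theorem IsExcisiveTriad.surjective_pathComponents {A₁ A₂ : Set X} {B₁ B₂ : Set Y}
    (hY : IsExcisiveTriad B₁ B₂) (h₁ : MapsTo φ A₁ B₁) (h₂ : MapsTo φ A₂ B₂)
    (hw₁ : IsWeakHomotopyEquivalence (h₁.restrict φ A₁ B₁))
    (hw₂ : IsWeakHomotopyEquivalence (h₂.restrict φ A₂ B₂)) (hφ : DSmooth φ) :
    Function.Surjective (PathComponents.map φ hφ) := by
  have key : ∀ {A : Set X} {B : Set Y} (h : MapsTo φ A B),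
      IsWeakHomotopyEquivalence (h.restrict φ A B) → ∀ y ∈ B,
      ∃ q, PathComponents.map φ hφ q = Quot.mk _ y := by
    intro A B h hw y hy
    obtain ⟨q, hq⟩ := (hw 0).surjective_pathComponents (Quot.mk _ ⟨y, hy⟩)
    obtain ⟨x, rfl⟩ := Quot.exists_rep q
    obtain ⟨γ, hγ, h0, h1⟩ := smoothlyJoined_of_eq (x := h.restrict φ A B x) hq
    exact ⟨Quot.mk _ x, Quot.sound ⟨fun s => γ s, (dSmooth_val B).comp hγ, congrArg Subtype.val h0,
      congrArg Subtype.val h1⟩⟩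
  intro q
  obtain ⟨y, rfl⟩ := Quot.exists_rep q
  have hy : y ∈ @interior Y dTopology B₁ ∪ @interior Y dTopology B₂ := by
    rw [show _ ∪ _ = univ from hY]; trivial
  rcases hy with hy | hy
  · exact key h₁ hw₁ y (@interior_subset Y dTopology B₁ _ hy)
  · exact key h₂ hw₂ y (@interior_subset Y dTopology B₂ _ hy)

end HomotopySets

end Diffeology

theorem mainTheorem3 {X : Type*} {Y : Type*} [DiffeologicalSpace X] [DiffeologicalSpace Y]
    (A₁ A₂ : Set X) (B₁ B₂ : Set Y)
    (hX : Diffeology.IsExcisiveTriad A₁ A₂) (hY : Diffeology.IsExcisiveTriad B₁ B₂)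
    (φ : X → Y) (hφ : Diffeology.DSmooth φ)
    (h₁ : Set.MapsTo φ A₁ B₁) (h₂ : Set.MapsTo φ A₂ B₂)
    (hw₁ : Diffeology.IsWeakHomotopyEquivalence (h₁.restrict φ A₁ B₁))
    (hw₂ : Diffeology.IsWeakHomotopyEquivalence (h₂.restrict φ A₂ B₂))
    (hw₁₂ : Diffeology.IsWeakHomotopyEquivalence
      ((h₁.inter_inter h₂).restrict φ (A₁ ∩ A₂) (B₁ ∩ B₂))) :
    Diffeology.IsWeakHomotopyEquivalence φ := fun _ =>
  { smooth := hφ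
    surjective_pathComponents := hY.surjective_pathComponents h₁ h₂ hw₁ hw₂ hφ
    injective := fun x n _ =>
      have : Nonempty X := ⟨x⟩
      (hX.cubeLiftProp hY h₁ h₂ hw₁ hw₂ hw₁₂).injective (Equiv.refl (Fin n)) hφ x
    surjective := fun x n _ =>
      have : Nonempty X := ⟨x⟩
      (hX.cubeLiftProp hY h₁ h₂ hw₁ hw₂ hw₁₂).surjective (Equiv.refl (Fin n)) hφ x }
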